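/- **Setting.** A plumbing graph $\Gamma$ is a finite simple graph (not necessarily connected, cycles allowed, all genera zero) with a totally ordered vertex set $\mathcal J$, $|\mathcal J|=s$, and integer decorations $e_j$. Let $L=\mathbb Z\langle E_j\rangle_{j\in\mathcal J}$ with the intersection form $(E_j,E_j)=e_j$ and, for $i\ne j$, $(E_i,E_j)=1$ or $0$ according to whether $(i,j)$ is an edge or not; $\Gamma$ is *non-degenerate* if the determinant of this form is non-zero. Let $L'=\{l'\in L\otimes\mathbb Q:(l',L)\subset\mathbb Z\}$, let $E_j^*\in L'$ be given by $(E_j^*,E_i)=-\delta_{ij}$, and let $Char=\{k\in L':-\tfrac12(k+l,l)\in\mathbb Z\text{ for all }l\in L\}$. Put $w(k)=-(k^2+s)/8$ and, for $I\subset\mathcal J$, $E_I=\sum_{j\in I}E_j$ and $w(k,I)=\max_{I'\subset I}w(k+2E_{I'})$. The $q$-cubes are the pairs $(k,I)\in Char\times\mathcal P(\mathcal J)$ with $|I|=q$. Let $\mathcal T_0^+=\mathbb Z[U,U^{-1}]/U\mathbb Z[U]$, and let $\mathcal F^q(\Gamma)$ be the $\mathbb Z[U]$-module of finitely supported functions from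 the $q$-cubes to $\mathcal T_0^+$, extended to combinations of cubes with coefficients in $\mathbb Z[U]$ by $\mathbb Z[U]$-linearity. Let $(\delta\phi)(\square)=\phi(\partial\square)$ with, for $I=\{j_1<\dots<j_q\}$, $$\partial(k,I)=\sum_{l=1}^q(-1)^l\Big(U^{w(k,I)-w(k,I\setminus j_l)}(k,I\setminus j_l)-U^{w(k,I)-w(k+2E_{j_l},I\setminus j_l)}(k+2E_{j_l},I\setminus j_l)\Big).$$ $\mathbb H^q(\Gamma)$ denotes the cohomology of the complex $(\mathcal F^*(\Gamma),\delta)$ (with $q\ge0$). Fix a vertex $j_0$. $\Gamma\setminus j_0$ is $\Gamma$ with $j_0$ and its adjacent edges deleted; $\Gamma_{j_0}^+$ is $\Gamma$ with $e_{j_0}$ replaced by $e_{j_0}+1$; $\Gamma^b$ is $\Gamma$ with a new vertex $j_{new}$ (the largest one in the ordering), of decoration $-1$, attached to $j_0$ by one new edge. *The map $\overline B^*:\mathcal F^*(\Gamma)\to\mathcal F^*(\Gamma\setminus j_0)$.* Fix a representative $r_{[k]}$ of every orbit $[k]=k+2L(\Gamma\setminus j_0)$ in $Char(\Gamma\setminus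 j_0)$. Let $b(\sum a_jE^*_{j,\Gamma\setminus j_0})=\sum a_jE^*_{j,\Gamma}$, and let $R:L'(\Gamma)\to L'(\Gamma\setminus j_0)$ be linear with $R(E^*_{j,\Gamma})=E^*_{j,\Gamma\setminus j_0}$ for $j\ne j_0$ and $R(E^*_{j_0,\Gamma})=0$. Then $(\overline B^q\phi)(k,I)=\sum_{a\equiv e_{j_0}(2)}(-1)^{n(k,a)/2}\,\phi(b(k)+aE^*_{j_0,\Gamma},I)$, where $n(k,a)=(k-r_{[k]},R(E_{j_0}))+a+e_{j_0}$. *The map $A^*:\mathcal F^*(\Gamma_{j_0}^+)\to\mathcal F^*(\Gamma)$.* Let $\pi_*:L(\Gamma^b)\otimes\mathbb Q\to L(\Gamma_{j_0}^+)\otimes\mathbb Q$ be linear with $\pi_*E_j=E_j$ and $\pi_*E_{new}=0$. Define $\pi_*^c:\mathcal F^*(\Gamma_{j_0}^+)\to\mathcal F^*(\Gamma^b)$ by $(\pi_*^c\phi)(k',I)=U^{w_{\Gamma^b}(k',I)-w_{\Gamma_{j_0}^+}(\pi_*k',I)}\phi(\pi_*k',I)$ if $j_{new}\notin I$, and $0$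 otherwise. Define $B^*:\mathcal F^*(\Gamma^b)\to\mathcal F^*(\Gamma)$ by $(B^q\phi)(k,I)=\sum_{a\equiv1(2)}\phi(b^b(k)+aE^*_{new,\Gamma^b},I)$, where $b^b(\sum a_jE^*_{j,\Gamma})=\sum a_jE^*_{j,\Gamma^b}$. Put $A^*=B^*\circ\pi_*^c$. **Theorem.** Let $\Gamma$ be a plumbing graph and $j_0$ a vertex such that $\Gamma_{j_0}^+$, $\Gamma$ and $\Gamma\setminus j_0$ are non-degenerate. Then, for every choice of the representatives $r_{[k]}$, $A^*$ and $\overline B^*$ are morphisms of complexes of $\mathbb Z[U]$-modules, and $$0\to\mathcal F^*(\Gamma_{j_0}^+)\xrightarrow{A^*}\mathcal F^*(\Gamma)\xrightarrow{\overline B^*}\mathcal F^*(\Gamma\setminus j_0)\to0$$ is a short exact sequence of complexes. Consequently, with the connecting homomorphisms $\mathbb C^q$ of this sequence, there is a long exact sequence of $\mathbb Z[U]$-modules $$0\to\mathbb H^0(\Gamma_{j_0}^+)\to\cdots\to\mathbb H^q(\Gamma_{j_0}^+)\xrightarrow{\mathbb A^q}\mathbb H^q(\Gamma)\xrightarrow{\overline{\mathbb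 B}^q}\mathbb H^q(\Gamma\setminus j_0)\xrightarrow{\mathbb C^q}\mathbb H^{q+1}(\Gamma_{j_0}^+)\to\cdots .$$ -/

import Mathlib

set_option linter.unusedSectionVars false

noncomputable section

open Polynomial LaurentPolynomial CategoryTheory

/-- A finite plumbing graph (all genera zero, no loops, no multiple edges): a simple graph on the
vertex set `J` with an integer decoration (Euler number) at every vertex. -/
structure PlumbingGraph (J : Type*) where
  graph : SimpleGraph J
  e : J → ℤ

namespace PlumbingGraph

universe u

section Lattice

variable {J : Type*} [Fintype J] [LinearOrder J]

open Classical in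
/-- The matrix of the intersection form in the basis `E_j`. -/
def form (Γ : PlumbingGraph J) : Matrix J J ℤ :=
  Matrix.of fun i j => if i = j then Γ.e i else if Γ.graph.Adj i j then 1 else 0

/-- The intersection form has non-zero determinant. -/
def Nondegenerate (Γ : PlumbingGraph J) : Prop := Γ.form.det ≠ 0

/-- The intersection matrix over `ℚ`. -/
def formQ (Γ : PlumbingGraph J) : Matrix J J ℚ := Γ.form.map (Int.cast : ℤ → ℚ)

/-- The intersection form `(x, y)` on `L ⊗ ℚ`; vectors of `L ⊗ ℚ` are given by their coordinates
in the basis `E_j`. -/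
def pairing (Γ : PlumbingGraph J) : LinearMap.BilinForm ℚ (J → ℚ) := Matrix.toBilin' Γ.formQ

/-- The basis vector `E_j` of `L`, seen in `L ⊗ ℚ`. -/
def E (j : J) : J → ℚ := Pi.single j 1

/-- The inclusion of `L = ℤ^J` in `L ⊗ ℚ`. -/
def lat (l : J → ℤ) : J → ℚ := fun j => (l j : ℚ)

/-- `E_I = ∑_{j ∈ I} E_j`. -/
def EI (I : Finset J) : J → ℚ := ∑ j ∈ I, E j

/-- The dual vector `E_j^*`, characterized (for a non-degenerate form) by
`(E_j^*, E_i) = -δ_{ij}`: minus the `j`-th column of the inverse intersection matrix. -/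
def Edual (Γ : PlumbingGraph J) (j : J) : J → ℚ := fun i => -(Γ.formQ⁻¹ i j)

/-- The dual lattice `L' = {l' ∈ L ⊗ ℚ : (l', L) ⊆ ℤ}`. -/
def dualLattice (Γ : PlumbingGraph J) : Set (J → ℚ) :=
  {x | ∀ l : J → ℤ, ∃ n : ℤ, Γ.pairing x (lat l) = n}

/-- `χ_k(l) = -(k + l, l) / 2`. -/
def chi (Γ : PlumbingGraph J) (k l : J → ℚ) : ℚ := -(1 / 2) * Γ.pairing (k + l) l

/-- The set of characteristic elements. -/
def Char (Γ : PlumbingGraph J) : Set (J → ℚ) :=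
  {k | k ∈ Γ.dualLattice ∧ ∀ l : J → ℤ, ∃ n : ℤ, Γ.chi k (lat l) = n}

/-- The weight `w(k) = -(k² + s) / 8`, where `s` is the number of vertices. -/
def weight (Γ : PlumbingGraph J) (k : J → ℚ) : ℚ := -(Γ.pairing k k + Fintype.card J) / 8

/-- The weight of the cube `(k, I)`: the maximum of `w(k + 2 E_{I'})` over `I' ⊆ I`. -/
def cubeWeight (Γ : PlumbingGraph J) (k : J → ℚ) (I : Finset J) : ℚ :=
  I.powerset.sup' ⟨∅, Finset.empty_mem_powerset I⟩ fun I' => Γ.weight (k + (2 : ℚ) • EI I')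

/-- `k ~ k'` if and only if `k' ∈ k + 2L`. -/
def orbitSetoid (Γ : PlumbingGraph J) : Setoid Γ.Char where
  r k k' := ∃ l : J → ℤ, (k' : J → ℚ) = k + (2 : ℚ) • lat l
  iseqv :=
    { refl := fun k => ⟨0, by ext; simp [lat]⟩
      symm := by
        rintro k k' ⟨l, hl⟩
        refine ⟨-l, ?_⟩
        rw [hl]; ext; simp [lat]
      trans := by
        rintro k k' k'' ⟨l, hl⟩ ⟨m, hm⟩
        refine ⟨l + m, ?_⟩
        rw [hm, hl]; ext; simp [lat]; ring }

/-- A choice of a representative `r_{[k]} ∈ [k]` for every orbit `[k] = k + 2L ⊆ Char`. -/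
structure OrbitRep (Γ : PlumbingGraph J) where
  rep : Quotient Γ.orbitSetoid → Γ.Char
  spec : ∀ c, Quotient.mk Γ.orbitSetoid (rep c) = c

theorem form_symm (Γ : PlumbingGraph J) (i j : J) : Γ.form i j = Γ.form j i := by
  simp only [form, Matrix.of_apply]
  by_cases h : i = j
  · subst h; rfl
  · rw [if_neg h, if_neg (Ne.symm h)]
    by_cases h' : Γ.graph.Adj i j
    · rw [if_pos h', if_pos h'.symm]
    · rw [if_neg h', if_neg fun h'' => h' h''.symm]

theorem form_of_adj (Γ : PlumbingGraph J) {i j : J} (h : Γ.graph.Adj i j) : Γ.form i j = 1 := by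
  simp [form, h, h.ne]

theorem form_of_not_adj (Γ : PlumbingGraph J) {i j : J} (hij : i ≠ j) (h : ¬Γ.graph.Adj i j) :
    Γ.form i j = 0 := by
  simp [form, h, hij]

theorem pairing_apply (Γ : PlumbingGraph J) (x y : J → ℚ) :
    Γ.pairing x y = ∑ i, ∑ j, x i * (Γ.form i j : ℚ) * y j := by
  simp [pairing, formQ, Matrix.toBilin'_apply]

theorem pairing_comm (Γ : PlumbingGraph J) (x y : J → ℚ) : Γ.pairing x y = Γ.pairing y x := by
  rw [pairing_apply, pairing_apply, Finset.sum_comm]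
  refine Finset.sum_congr rfl fun i _ => Finset.sum_congr rfl fun j _ => ?_
  rw [form_symm]; ring

theorem pairing_E (Γ : PlumbingGraph J) (x : J → ℚ) (j : J) :
    Γ.pairing x (E j) = ∑ i, x i * (Γ.form i j : ℚ) := by
  rw [pairing_apply]
  refine Finset.sum_congr rfl fun i _ => ?_
  rw [Finset.sum_eq_single j] <;> simp +contextual [E]

theorem pairing_E_E (Γ : PlumbingGraph J) (i j : J) : Γ.pairing (E i) (E j) = Γ.form i j := by
  rw [pairing_E, Finset.sum_eq_single i] <;> simp +contextual [E]

theorem Nondegenerate.isUnit {Γ : PlumbingGraph J} (h : Γ.Nondegenerate) :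
    IsUnit Γ.formQ.det := by
  have : Γ.formQ.det = (Γ.form.det : ℚ) := by
    have := Int.cast_det (R := ℚ) Γ.form
    rw [this]; rfl
  rw [this, isUnit_iff_ne_zero]
  exact_mod_cast h

theorem Nondegenerate.pairing_Edual {Γ : PlumbingGraph J} (h : Γ.Nondegenerate) (i j : J) :
    Γ.pairing (Γ.Edual j) (E i) = if i = j then -1 else 0 := by
  have h1 := congrFun (congrFun (Matrix.mul_nonsing_inv Γ.formQ h.isUnit) i) j
  rw [Matrix.mul_apply, Matrix.one_apply] at h1
  rw [pairing_E]
  have : ∑ l, Γ.Edual j l * (Γ.form l i : ℚ) = -∑ l, Γ.formQ i l * Γ.formQ⁻¹ l j := by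
    rw [← Finset.sum_neg_distrib]
    refine Finset.sum_congr rfl fun l _ => ?_
    simp only [Edual, formQ, Matrix.map_apply]
    rw [form_symm Γ l i]; ring
  rw [this, h1]
  split_ifs <;> simp

theorem Nondegenerate.ext {Γ : PlumbingGraph J} (h : Γ.Nondegenerate) {x y : J → ℚ}
    (hxy : ∀ j, Γ.pairing x (E j) = Γ.pairing y (E j)) : x = y := by
  have hv : Matrix.vecMul x Γ.formQ = Matrix.vecMul y Γ.formQ := by
    ext j
    have := hxy j
    rw [pairing_E, pairing_E] at this
    simpa [Matrix.vecMul, dotProduct, formQ] using this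
  have := congrArg (fun z => Matrix.vecMul z Γ.formQ⁻¹) hv
  simpa [Matrix.vecMul_vecMul, Matrix.mul_nonsing_inv _ h.isUnit] using this

theorem lat_single (j : J) : lat (Pi.single j 1 : J → ℤ) = E j := by
  ext i
  by_cases h : i = j
  · subst h; simp [lat, E]
  · simp [lat, E, h]

theorem lat_add (l m : J → ℤ) : lat (l + m) = lat l + lat m := by ext; simp [lat]

theorem lat_neg (l : J → ℤ) : lat (-l) = -lat l := by ext; simp [lat]

theorem EI_eq_lat (I : Finset J) : EI I = lat (∑ j ∈ I, Pi.single j (1 : ℤ)) := by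
  ext i
  simp [EI, lat, E, Finset.sum_apply, Pi.single_apply]

theorem pairing_lat_lat (Γ : PlumbingGraph J) (l m : J → ℤ) :
    ∃ n : ℤ, Γ.pairing (lat l) (lat m) = n :=
  ⟨∑ i, ∑ j, l i * Γ.form i j * m j, by rw [pairing_apply]; simp [lat]⟩

theorem form_self (Γ : PlumbingGraph J) (j : J) : Γ.form j j = Γ.e j := by simp [form]

theorem mem_Char_iff (Γ : PlumbingGraph J) (k : J → ℚ) :
    k ∈ Γ.Char ↔ ∀ j, ∃ n : ℤ, Γ.pairing k (E j) = Γ.e j + 2 * n := by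
  constructor
  · rintro ⟨-, h⟩ j
    obtain ⟨n, hn⟩ := h (Pi.single j 1)
    rw [lat_single, chi, map_add, LinearMap.add_apply, pairing_E_E, form_self] at hn
    exact ⟨-n - Γ.e j, by push_cast; linarith⟩
  · intro h
    let P : AddSubgroup (J → ℤ) :=
      { carrier := {l | (∃ n : ℤ, Γ.pairing k (lat l) = n) ∧ ∃ n : ℤ, Γ.chi k (lat l) = n}
        zero_mem' := by
          have : lat (0 : J → ℤ) = 0 := by ext; simp [lat]
          simp only [Set.mem_ofPred_eq, this, chi, map_zero]
          exact ⟨⟨0, by simp⟩, ⟨0, by simp⟩⟩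
        add_mem' := by
          rintro l m ⟨⟨a, ha⟩, b, hb⟩ ⟨⟨c, hc⟩, d, hd⟩
          obtain ⟨n, hn⟩ := Γ.pairing_lat_lat l m
          have hn' := hn
          rw [pairing_comm] at hn'
          refine ⟨⟨a + c, by rw [lat_add, map_add, ha, hc]; push_cast; rfl⟩, b + d - n, ?_⟩
          simp only [chi, lat_add, map_add, LinearMap.add_apply] at hb hd ⊢
          push_cast
          linarith
        neg_mem' := by
          rintro l ⟨⟨a, ha⟩, b, hb⟩
          obtain ⟨n, hn⟩ := Γ.pairing_lat_lat l l
          refine ⟨⟨-a, by rw [lat_neg, map_neg, ha]; push_cast; rfl⟩, -b - n, ?_⟩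
          simp only [chi, lat_neg, map_add, map_neg, LinearMap.add_apply, LinearMap.neg_apply]
            at hb ⊢
          push_cast
          linarith }
    have hP : ∀ j, (Pi.single j 1 : J → ℤ) ∈ P := by
      intro j
      obtain ⟨n, hn⟩ := h j
      refine ⟨⟨Γ.e j + 2 * n, by rw [lat_single, hn]; push_cast; rfl⟩, -Γ.e j - n, ?_⟩
      rw [lat_single, chi, map_add, LinearMap.add_apply, pairing_E_E, form_self, hn]
      push_cast; ring
    have hall : ∀ l : J → ℤ, l ∈ P := by
      intro l
      have : l = ∑ j, l j • (Pi.single j 1 : J → ℤ) := by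
        ext i; simp [Finset.sum_apply, Pi.single_apply]
      rw [this]
      exact sum_mem fun j _ => zsmul_mem (hP j) _
    exact ⟨fun l => (hall l).1, fun l => (hall l).2⟩

theorem weight_add (Γ : PlumbingGraph J) (k x : J → ℚ) :
    Γ.weight (k + (2 : ℚ) • x) = Γ.weight k + Γ.chi k x := by
  simp only [weight, chi, map_add, map_smul, LinearMap.add_apply, LinearMap.smul_apply,
    smul_eq_mul, Γ.pairing_comm x k]
  ring

theorem shift_mem (Γ : PlumbingGraph J) {k : J → ℚ} (hk : k ∈ Γ.Char) (j : J) :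
    k + (2 : ℚ) • E j ∈ Γ.Char := by
  rw [mem_Char_iff] at hk ⊢
  intro i
  obtain ⟨n, hn⟩ := hk i
  refine ⟨n + Γ.form j i, ?_⟩
  rw [map_add, map_smul, LinearMap.add_apply, LinearMap.smul_apply, pairing_E_E, hn, smul_eq_mul]
  push_cast; ring

/-- The characteristic element `k + 2 E_j`. -/
def shift (Γ : PlumbingGraph J) (k : Γ.Char) (j : J) : Γ.Char :=
  ⟨k + (2 : ℚ) • E j, Γ.shift_mem k.2 j⟩

/-- `w` of a cube and of its initial vertex differ by an integer. -/
theorem cubeWeight_int (Γ : PlumbingGraph J) (k : Γ.Char) (I : Finset J) :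
    ∃ n : ℤ, Γ.cubeWeight k I = Γ.weight k + n := by
  obtain ⟨I', -, h⟩ := Finset.exists_mem_eq_sup' (s := I.powerset)
    ⟨∅, Finset.empty_mem_powerset I⟩ fun I' => Γ.weight ((k : J → ℚ) + (2 : ℚ) • EI I')
  obtain ⟨n, hn⟩ := k.2.2 (∑ j ∈ I', Pi.single j (1 : ℤ))
  refine ⟨n, ?_⟩
  rw [cubeWeight, h, weight_add, EI_eq_lat, hn]

theorem cubeWeight_erase_le (Γ : PlumbingGraph J) (k : J → ℚ) (I : Finset J) (j : J) :
    Γ.cubeWeight k (I.erase j) ≤ Γ.cubeWeight k I :=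
  Finset.sup'_mono _ (Finset.powerset_mono.2 (Finset.erase_subset _ _)) _

theorem cubeWeight_shift_erase_le (Γ : PlumbingGraph J) (k : J → ℚ) {I : Finset J} {j : J}
    (hj : j ∈ I) : Γ.cubeWeight (k + (2 : ℚ) • E j) (I.erase j) ≤ Γ.cubeWeight k I := by
  refine Finset.sup'_le _ _ fun I' hI' => ?_
  rw [Finset.mem_powerset] at hI'
  have hj' : j ∉ I' := fun h => Finset.notMem_erase j I (hI' h)
  have : k + (2 : ℚ) • E j + (2 : ℚ) • EI I' = k + (2 : ℚ) • EI (insert j I') := by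
    rw [EI, EI, Finset.sum_insert hj', smul_add, add_assoc]
  rw [this]
  refine Finset.le_sup' (fun I' => Γ.weight (k + (2 : ℚ) • EI I')) ?_
  rw [Finset.mem_powerset]
  exact Finset.insert_subset hj (hI'.trans (Finset.erase_subset _ _))

end Lattice

section Complex

/-- The submodule `U ℤ[U]` of `ℤ[U, U⁻¹]`. -/
def tSub : Submodule ℤ[X] ℤ[T;T⁻¹] := Submodule.span ℤ[X] {LaurentPolynomial.T 1}

/-- The `ℤ[U]`-module `𝒯₀⁺ = ℤ[U, U⁻¹] / U ℤ[U]`; the variable `U` is the polynomial variable `X`. -/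
abbrev Tower : Type := ℤ[T;T⁻¹] ⧸ tSub

/-- The power `U^x`, used only for exponents `x` that are non-negative integers. -/
def Upow (x : ℚ) : ℤ[X] := X ^ ⌊x⌋₊

theorem Upow_mul {x y : ℚ} (hx : 0 ≤ x) (hy : 0 ≤ y) (hx' : ∃ n : ℤ, x = n) :
    Upow x * Upow y = Upow (x + y) := by
  obtain ⟨n, rfl⟩ := hx'
  lift n to ℕ using (by exact_mod_cast hx)
  rw [Upow, Upow, Upow, ← pow_add, Int.cast_natCast, add_comm ((n : ℕ) : ℚ) y,
    Nat.floor_add_natCast hy, Nat.floor_natCast, add_comm]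

/-- Every element of `𝒯₀⁺` is killed by a power of `U`. -/
theorem tower_torsion (t : Tower) : ∃ N : ℕ, ∀ n, N ≤ n → (X ^ n : ℤ[X]) • t = 0 := by
  obtain ⟨f, rfl⟩ := Submodule.Quotient.mk_surjective _ t
  obtain ⟨n, f', hf⟩ := LaurentPolynomial.exists_T_pow f
  refine ⟨n + 1, fun m hm => ?_⟩
  obtain ⟨d, rfl⟩ := Nat.exists_eq_add_of_le hm
  rw [← Submodule.Quotient.mk_smul, Submodule.Quotient.mk_eq_zero]
  refine Submodule.mem_span_singleton.2 ⟨X ^ d * f', ?_⟩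
  change Polynomial.toLaurent _ * _ = Polynomial.toLaurent _ * _
  rw [map_mul, map_pow, map_pow, Polynomial.toLaurent_X, hf, LaurentPolynomial.T_pow,
    LaurentPolynomial.T_pow]
  have : (LaurentPolynomial.T (((n + 1 + d : ℕ) : ℤ) * 1) : ℤ[T;T⁻¹]) =
      LaurentPolynomial.T ((d : ℤ) * 1) * LaurentPolynomial.T n * LaurentPolynomial.T 1 := by
    rw [← LaurentPolynomial.T_add, ← LaurentPolynomial.T_add]
    congr 1; push_cast; ring
  rw [this]; ring

variable {J : Type u} [Fintype J] [LinearOrder J]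

/-- The set `𝒬_q` of `q`-cubes: pairs `(k, I)` with `k ∈ Char` and `I ⊆ J`, `|I| = q`. The cube
`(k, I)` has the vertices `k + 2 E_{I'}`, `I' ⊆ I`. -/
abbrev Cube (Γ : PlumbingGraph J) (q : ℕ) : Type u := {c : Γ.Char × Finset J // c.2.card = q}

/-- The cochain module `ℱ^q`: finitely supported functions from the `q`-cubes to `𝒯₀⁺`. -/
abbrev Cochain (Γ : PlumbingGraph J) (q : ℕ) : Type u := Γ.Cube q →₀ Tower

variable {Γ : PlumbingGraph J} {q : ℕ}

/-- The value `φ((k, I))` of a `q`-cochain; it is defined to be `0` if `|I| ≠ q`. -/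
def ev (φ : Γ.Cochain q) (k : Γ.Char) (I : Finset J) : Tower :=
  if h : I.card = q then φ ⟨(k, I), h⟩ else 0

theorem ev_of_card (φ : Γ.Cochain q) (c : Γ.Cube q) : φ c = ev φ c.1.1 c.1.2 := by
  rw [ev, dif_pos c.2]

theorem ev_add (φ ψ : Γ.Cochain q) (k : Γ.Char) (I : Finset J) :
    ev (φ + ψ) k I = ev φ k I + ev ψ k I := by
  unfold ev; split_ifs <;> simp

theorem ev_smul (p : ℤ[X]) (φ : Γ.Cochain q) (k : Γ.Char) (I : Finset J) :
    ev (p • φ) k I = p • ev φ k I := by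
  unfold ev; split_ifs <;> simp

theorem ev_finite (φ : Γ.Cochain q) :
    {c : Γ.Char × Finset J | ev φ c.1 c.2 ≠ 0}.Finite := by
  refine (φ.support.finite_toSet.image Subtype.val).subset ?_
  rintro ⟨k, I⟩ h
  change ev φ k I ≠ 0 at h
  unfold ev at h
  split_ifs at h with hc
  · exact ⟨⟨(k, I), hc⟩, by simpa using h, rfl⟩
  · exact absurd rfl h

/-- The sign `(-1)^l`, where `j` is the `l`-th element of `I` (counted from `1`). -/
def sgn (I : Finset J) (j : J) : ℤ := (-1) ^ (I.filter (· ≤ j)).card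

/-- The value of `δφ` at the cube `(k, I)`, that is, the value of `φ` at
`∂(k, I) = ∑_l (-1)^l (U^{w(k,I) - w(k,I∖j_l)} (k, I∖j_l)
  - U^{w(k,I) - w(k+2E_{j_l},I∖j_l)} (k + 2E_{j_l}, I∖j_l))`. -/
def deltaVal (φ : Γ.Cochain q) (k : Γ.Char) (I : Finset J) : Tower :=
  ∑ j ∈ I, sgn I j •
    (Upow (Γ.cubeWeight k I - Γ.cubeWeight k (I.erase j)) • ev φ k (I.erase j) -
      Upow (Γ.cubeWeight k I - Γ.cubeWeight (Γ.shift k j) (I.erase j)) •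
        ev φ (Γ.shift k j) (I.erase j))

theorem shift_injective (j : J) : Function.Injective fun k : Γ.Char => Γ.shift k j := by
  intro k k' h
  exact Subtype.ext (add_right_cancel (congrArg Subtype.val h))

theorem erase_injOn (j : J) :
    Set.InjOn (fun c : Γ.Char × Finset J => (c.1, c.2.erase j)) {c | j ∈ c.2} := by
  rintro ⟨k, I⟩ hI ⟨k', I'⟩ hI' h
  simp only [Prod.mk.injEq] at h
  have : I = I' := by
    have := congrArg (insert j) h.2
    rwa [Finset.insert_erase hI, Finset.insert_erase hI'] at this
  rw [h.1, this]

theorem deltaVal_finite (φ : Γ.Cochain q) :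
    (Function.support fun c : Γ.Cube (q + 1) => deltaVal φ c.1.1 c.1.2).Finite := by
  have h1 : ∀ j : J, {c : Γ.Char × Finset J | j ∈ c.2 ∧ ev φ c.1 (c.2.erase j) ≠ 0}.Finite := by
    intro j
    refine Set.Finite.of_finite_image (f := fun c : Γ.Char × Finset J => (c.1, c.2.erase j))
      ((ev_finite φ).subset ?_) ((erase_injOn j).mono fun c hc => hc.1)
    rintro _ ⟨c, hc, rfl⟩
    exact hc.2
  have h2 : ∀ j : J, {c : Γ.Char × Finset J |
      j ∈ c.2 ∧ ev φ (Γ.shift c.1 j) (c.2.erase j) ≠ 0}.Finite := by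
    intro j
    refine Set.Finite.of_finite_image
      (f := fun c : Γ.Char × Finset J => (Γ.shift c.1 j, c.2.erase j))
      ((ev_finite φ).subset ?_) ?_
    · rintro _ ⟨c, hc, rfl⟩
      exact hc.2
    · rintro ⟨k, I⟩ hI ⟨k', I'⟩ hI' h
      simp only [Prod.mk.injEq] at h
      refine erase_injOn j hI.1 hI'.1 ?_
      rw [Prod.mk.injEq]
      exact ⟨shift_injective j h.1, h.2⟩
  refine Set.Finite.of_finite_image (f := Subtype.val)
    ((Set.finite_iUnion fun j => (h1 j).union (h2 j)).subset ?_) Subtype.val_injective.injOn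
  rintro _ ⟨c, hc, rfl⟩
  obtain ⟨j, hj, hne⟩ := Finset.exists_ne_zero_of_sum_ne_zero hc
  refine Set.mem_iUnion.2 ⟨j, ?_⟩
  by_contra hcon
  rw [Set.mem_union, not_or] at hcon
  have e1 : ev φ c.1.1 (c.1.2.erase j) = 0 := by
    by_contra h; exact hcon.1 ⟨hj, h⟩
  have e2 : ev φ (Γ.shift c.1.1 j) (c.1.2.erase j) = 0 := by
    by_contra h; exact hcon.2 ⟨hj, h⟩
  exact hne (by rw [e1, e2]; simp)

/-- The coboundary `δ : ℱ^q → ℱ^{q+1}`, a `ℤ[U]`-linear map. -/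
def delta (Γ : PlumbingGraph J) (q : ℕ) : Γ.Cochain q →ₗ[ℤ[X]] Γ.Cochain (q + 1) where
  toFun φ := Finsupp.ofSupportFinite (fun c => deltaVal φ c.1.1 c.1.2) (deltaVal_finite φ)
  map_add' φ ψ := by
    ext c
    simp only [Finsupp.ofSupportFinite_coe, Finsupp.coe_add, Pi.add_apply, deltaVal, ev_add,
      ← Finset.sum_add_distrib]
    refine Finset.sum_congr rfl fun j _ => ?_
    simp only [smul_add, smul_sub]; abel
  map_smul' p φ := by
    ext c
    simp only [Finsupp.ofSupportFinite_coe, Finsupp.coe_smul, Pi.smul_apply, deltaVal, ev_smul,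
      Finset.smul_sum, RingHom.id_apply]
    refine Finset.sum_congr rfl fun j _ => ?_
    simp only [smul_sub, smul_comm p]

theorem ev_delta (φ : Γ.Cochain q) (k : Γ.Char) {I : Finset J} (hI : I.card = q + 1) :
    ev (Γ.delta q φ) k I = deltaVal φ k I := by
  rw [ev, dif_pos hI]; rfl

theorem sgn_swap {I : Finset J} {i j : J} (hi : i ∈ I) (hj : j ∈ I) (hij : i ≠ j) :
    sgn I j * sgn (I.erase j) i = -(sgn I i * sgn (I.erase i) j) := by
  wlog h : i < j generalizing i j
  · rw [this hj hi hij.symm (lt_of_le_of_ne (not_lt.1 h) hij.symm), neg_neg]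
  have e1 : (I.erase j).filter (· ≤ i) = I.filter (· ≤ i) := by
    rw [← Finset.erase_eq_of_notMem (s := I.filter (· ≤ i)) (a := j) (by simp [h]),
      Finset.filter_erase]
  have e2 : (I.filter (· ≤ j)).card = ((I.erase i).filter (· ≤ j)).card + 1 := by
    rw [Finset.filter_erase, Finset.card_erase_add_one]
    simp [hi, h.le]
  simp only [sgn, e1, e2, pow_succ]
  ring

/-- The exponents of `U` that occur in `δ` are non-negative integers. -/
theorem exp_int (k : Γ.Char) (I I' : Finset J) :
    ∃ n : ℤ, Γ.cubeWeight k I - Γ.cubeWeight k I' = n := by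
  obtain ⟨a, ha⟩ := Γ.cubeWeight_int k I
  obtain ⟨b, hb⟩ := Γ.cubeWeight_int k I'
  exact ⟨a - b, by rw [ha, hb]; push_cast; ring⟩

theorem weight_shift_int (k : Γ.Char) (j : J) : ∃ n : ℤ, Γ.weight (Γ.shift k j) = Γ.weight k + n := by
  obtain ⟨n, hn⟩ := k.2.2 (Pi.single j 1)
  exact ⟨n, by rw [shift, weight_add, ← lat_single, hn]⟩

theorem exp_shift_int (k : Γ.Char) (j : J) (I I' : Finset J) :
    ∃ n : ℤ, Γ.cubeWeight k I - Γ.cubeWeight (Γ.shift k j) I' = n := by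
  obtain ⟨a, ha⟩ := Γ.cubeWeight_int k I
  obtain ⟨b, hb⟩ := Γ.cubeWeight_int (Γ.shift k j) I'
  obtain ⟨c, hc⟩ := weight_shift_int k j
  exact ⟨a - b - c, by rw [ha, hb, hc]; push_cast; ring⟩

theorem shift_comm (k : Γ.Char) (i j : J) :
    Γ.shift (Γ.shift k i) j = Γ.shift (Γ.shift k j) i :=
  Subtype.ext (add_right_comm _ _ _)

theorem delta_delta (φ : Γ.Cochain q) : Γ.delta (q + 1) (Γ.delta q φ) = 0 := by
  ext ⟨⟨k, I⟩, hI⟩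
  change deltaVal (Γ.delta q φ) k I = 0
  replace hI : I.card = q + 1 + 1 := hI
  let V : Γ.Char → Finset J → Tower := fun k' I' =>
    Upow (Γ.cubeWeight k I - Γ.cubeWeight k' I') • ev φ k' I'
  have key : deltaVal (Γ.delta q φ) k I = ∑ j ∈ I, ∑ i ∈ I.erase j,
      (sgn I j * sgn (I.erase j) i) •
        (V k ((I.erase j).erase i) - V (Γ.shift k i) ((I.erase j).erase i)
          - (V (Γ.shift k j) ((I.erase j).erase i)
            - V (Γ.shift (Γ.shift k j) i) ((I.erase j).erase i))) := by
    refine Finset.sum_congr rfl fun j hj => ?_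
    have hc : (I.erase j).card = q + 1 := by rw [Finset.card_erase_of_mem hj, hI]; rfl
    rw [ev_delta _ _ hc, ev_delta _ _ hc, deltaVal, deltaVal, Finset.smul_sum, Finset.smul_sum,
      ← Finset.sum_sub_distrib, Finset.smul_sum]
    refine Finset.sum_congr rfl fun i hi => ?_
    rw [smul_comm (Upow _) (sgn (I.erase j) i), smul_comm (Upow _) (sgn (I.erase j) i), ← smul_sub,
      ← mul_smul]
    congr 1
    simp only [smul_sub, ← mul_smul]
    have f1 := sub_nonneg.2 (Γ.cubeWeight_erase_le k I j)
    have f2 : 0 ≤ Γ.cubeWeight k I - Γ.cubeWeight (Γ.shift k j) (I.erase j) :=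
      sub_nonneg.2 (Γ.cubeWeight_shift_erase_le k hj)
    have f3 := fun k => sub_nonneg.2 (Γ.cubeWeight_erase_le k (I.erase j) i)
    have f4 : ∀ k : Γ.Char, 0 ≤ Γ.cubeWeight k (I.erase j) -
        Γ.cubeWeight (Γ.shift k i) ((I.erase j).erase i) :=
      fun k => sub_nonneg.2 (Γ.cubeWeight_shift_erase_le k hi)
    rw [Upow_mul f1 (f3 _) (exp_int _ _ _), Upow_mul f1 (f4 _) (exp_int _ _ _),
      Upow_mul f2 (f3 _) (exp_shift_int _ _ _ _), Upow_mul f2 (f4 _) (exp_shift_int _ _ _ _)]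
    simp only [sub_add_sub_cancel]
    rfl
  rw [key, Finset.sum_sigma']
  refine Finset.sum_involution (fun p _ => ⟨p.2, p.1⟩) ?_ ?_ ?_ ?_
  · rintro ⟨j, i⟩ h
    simp only [Finset.mem_sigma, Finset.mem_erase] at h
    rw [sgn_swap h.2.2 h.1 h.2.1, Finset.erase_right_comm (a := i) (b := j), shift_comm k i j,
      neg_smul, neg_add_eq_zero]
    congr 1
    abel
  · rintro ⟨j, i⟩ h _ heq
    simp only [Finset.mem_sigma, Finset.mem_erase] at h
    simp only [Sigma.mk.injEq] at heq
    exact h.2.1 heq.1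
  · rintro ⟨j, i⟩ h
    simp only [Finset.mem_sigma, Finset.mem_erase] at h ⊢
    exact ⟨h.2.2, h.2.1.symm, h.1⟩
  · rintro ⟨j, i⟩ h
    rfl

/-- The lattice cochain complex `(ℱ^*(Γ), δ)` of `ℤ[U]`-modules. -/
def latticeComplex (Γ : PlumbingGraph J) : CochainComplex (ModuleCat.{u} ℤ[X]) ℕ :=
  CochainComplex.of (fun q => ModuleCat.of ℤ[X] (Γ.Cochain q))
    (fun q => ModuleCat.ofHom (Γ.delta q)) fun q => by
      ext1; exact LinearMap.ext fun φ => delta_delta φ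

/-- The lattice cohomology `ℍ^q(Γ)`. -/
abbrev latticeCohomology (Γ : PlumbingGraph J) (q : ℕ) : ModuleCat.{u} ℤ[X] :=
  Γ.latticeComplex.homology q

/-- A family of `ℤ[U]`-linear maps commuting with `δ`, as a morphism of complexes. -/
def complexHom {J' : Type u} [Fintype J'] [LinearOrder J'] {Γ : PlumbingGraph J}
    {Γ' : PlumbingGraph J'} (f : ∀ q, Γ.Cochain q →ₗ[ℤ[X]] Γ'.Cochain q)
    (hf : ∀ q φ, Γ'.delta q (f q φ) = f (q + 1) (Γ.delta q φ)) :
    Γ.latticeComplex ⟶ Γ'.latticeComplex :=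
  CochainComplex.ofHom (fun q => ModuleCat.ofHom (f q)) fun q => by
    simp only [latticeComplex, CochainComplex.of_d]
    ext1; exact LinearMap.ext fun φ => hf q φ

end Complex

section Deletion

variable {J V : Type u} [Fintype J] [LinearOrder J] [Fintype V] [LinearOrder V]

/-- `Γ` is the graph obtained from `Δ` by deleting the vertex `v` and the edges adjacent to it;
`ι` is the (order preserving) inclusion of the vertex set of `Γ` in that of `Δ`. -/
structure IsVertexDeletion (Γ : PlumbingGraph J) (Δ : PlumbingGraph V) (v : V) (ι : J ↪o V) :
    Prop where
  range_eq : Set.range ι = {v}ᶜ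
  graph_eq : Γ.graph = Δ.graph.comap ι
  e_eq : ∀ j, Γ.e j = Δ.e (ι j)

/-- The operator `b : ∑_j a_j E^*_{j,Γ} ↦ ∑_j a_j E^*_{j,Δ}`; the coefficient of `l'` at `E_j^*` is
`a_j = -(l', E_j)`. -/
def bMap (Γ : PlumbingGraph J) (Δ : PlumbingGraph V) (ι : J ↪o V) (l' : J → ℚ) : V → ℚ :=
  ∑ j, (-Γ.pairing l' (E j)) • Δ.Edual (ι j)

/-- The restriction `R : L'(Δ) → L'(Γ)`, `R(E^*_{j,Δ}) = E^*_{j,Γ}` for `j ≠ v` and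
`R(E^*_{v,Δ}) = 0`. -/
def resMap (Γ : PlumbingGraph J) (Δ : PlumbingGraph V) (ι : J ↪o V) (l' : V → ℚ) : J → ℚ :=
  ∑ j, (-Δ.pairing l' (E (ι j))) • Γ.Edual j

variable {Γ : PlumbingGraph J} {Δ : PlumbingGraph V} {v : V} {ι : J ↪o V}

theorem IsVertexDeletion.ne (h : IsVertexDeletion Γ Δ v ι) (j : J) : ι j ≠ v := by
  have : ι j ∈ ({v}ᶜ : Set V) := h.range_eq ▸ Set.mem_range_self j
  simpa using this

theorem IsVertexDeletion.cases (h : IsVertexDeletion Γ Δ v ι) (x : V) : x = v ∨ ∃ j, ι j = x := by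
  by_cases hx : x = v
  · exact Or.inl hx
  · have : x ∈ Set.range ι := by rw [h.range_eq]; exact hx
    exact Or.inr this

theorem IsVertexDeletion.form_eq (h : IsVertexDeletion Γ Δ v ι) (i j : J) :
    Δ.form (ι i) (ι j) = Γ.form i j := by
  have hadj : Γ.graph.Adj i j ↔ Δ.graph.Adj (ι i) (ι j) := by
    rw [h.graph_eq, SimpleGraph.comap_adj]
  by_cases hij : i = j
  · subst hij; rw [form_self, form_self, h.e_eq]
  · have hij' : ι i ≠ ι j := fun h' => hij (ι.injective h')
    by_cases ha : Γ.graph.Adj i j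
    · rw [form_of_adj Γ ha, form_of_adj Δ (hadj.1 ha)]
    · rw [form_of_not_adj Γ hij ha, form_of_not_adj Δ hij' fun h' => ha (hadj.2 h')]

theorem pairing_lift_ι (h : IsVertexDeletion Γ Δ v ι) (hΔ : Δ.Nondegenerate) (k : J → ℚ) (a : ℚ)
    (i : J) : Δ.pairing (bMap Γ Δ ι k + a • Δ.Edual v) (E (ι i)) = Γ.pairing k (E i) := by
  simp only [bMap, map_add, map_sum, map_smul, LinearMap.add_apply, LinearMap.sum_apply,
    LinearMap.smul_apply, hΔ.pairing_Edual, smul_eq_mul, h.ne, ι.injective.eq_iff]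
  rw [Finset.sum_eq_single i] <;> simp +contextual [eq_comm]

theorem pairing_lift_v (h : IsVertexDeletion Γ Δ v ι) (hΔ : Δ.Nondegenerate) (k : J → ℚ) (a : ℚ) :
    Δ.pairing (bMap Γ Δ ι k + a • Δ.Edual v) (E v) = -a := by
  simp only [bMap, map_add, map_sum, map_smul, LinearMap.add_apply, LinearMap.sum_apply,
    LinearMap.smul_apply, hΔ.pairing_Edual, smul_eq_mul, (h.ne _).symm]
  simp

theorem lift_mem (h : IsVertexDeletion Γ Δ v ι) (hΔ : Δ.Nondegenerate) {k : J → ℚ}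
    (hk : k ∈ Γ.Char) {a : ℤ} (ha : a ≡ Δ.e v [ZMOD 2]) :
    bMap Γ Δ ι k + (a : ℚ) • Δ.Edual v ∈ Δ.Char := by
  rw [mem_Char_iff] at hk ⊢
  intro x
  rcases h.cases x with rfl | ⟨j, rfl⟩
  · obtain ⟨c, hc⟩ := ha.dvd
    refine ⟨c - Δ.e x, ?_⟩
    rw [pairing_lift_v h hΔ]
    have : (Δ.e x : ℚ) - a = 2 * c := by exact_mod_cast hc
    push_cast; linarith
  · rw [pairing_lift_ι h hΔ, ← h.e_eq]
    exact hk j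

/-- The characteristic element `b(k) + a E_v^*` of `Δ`, where `k ∈ Char(Γ)`, `a ≡ e_v (mod 2)`. -/
def lift (h : IsVertexDeletion Γ Δ v ι) (hΔ : Δ.Nondegenerate) (k : Γ.Char)
    (a : {a : ℤ // a ≡ Δ.e v [ZMOD 2]}) : Δ.Char :=
  ⟨bMap Γ Δ ι k + ((a : ℤ) : ℚ) • Δ.Edual v, lift_mem h hΔ k.2 a.2⟩

theorem lift_injective (h : IsVertexDeletion Γ Δ v ι) (hΔ : Δ.Nondegenerate)
    (hΓ : Γ.Nondegenerate) : Function.Injective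
      fun p : Γ.Char × {a : ℤ // a ≡ Δ.e v [ZMOD 2]} => lift h hΔ p.1 p.2 := by
  rintro ⟨k, a⟩ ⟨k', a'⟩ heq
  have heq' := congrArg Subtype.val heq
  simp only [lift] at heq'
  have h1 := congrArg (fun x => Δ.pairing x (E v)) heq'
  simp only [pairing_lift_v h hΔ] at h1
  have h2 : (k : J → ℚ) = k' := hΓ.ext fun j => by
    have := congrArg (fun x => Δ.pairing x (E (ι j))) heq'
    simpa only [pairing_lift_ι h hΔ] using this
  rw [Prod.mk.injEq]
  exact ⟨Subtype.ext h2, Subtype.ext (by exact_mod_cast neg_injective h1)⟩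

/-- The value at the cube `(k, I)` of `Γ` of the cochain dual to the operator
`(k, I) ↦ ∑_{a ≡ e_v (mod 2)} ε(k, a) (b(k) + a E_v^*, I)`; the sum has only finitely many non-zero
terms, as `φ` has finite support. -/
def bVal {q : ℕ} (h : IsVertexDeletion Γ Δ v ι) (hΔ : Δ.Nondegenerate) (ε : Γ.Char → ℤ → ℤ)
    (φ : Δ.Cochain q) (k : Γ.Char) (I : Finset J) : Tower :=
  ∑ᶠ a : {a : ℤ // a ≡ Δ.e v [ZMOD 2]}, ε k a • ev φ (lift h hΔ k a) (I.map ι.toEmbedding)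

theorem bVal_term_finite {q : ℕ} (h : IsVertexDeletion Γ Δ v ι) (hΔ : Δ.Nondegenerate)
    (hΓ : Γ.Nondegenerate) (φ : Δ.Cochain q) :
    {p : Γ.Char × Finset J × {a : ℤ // a ≡ Δ.e v [ZMOD 2]} |
      ev φ (lift h hΔ p.1 p.2.2) (p.2.1.map ι.toEmbedding) ≠ 0}.Finite := by
  refine Set.Finite.of_finite_image
    (f := fun p => (lift h hΔ p.1 p.2.2, p.2.1.map ι.toEmbedding))
    ((ev_finite φ).subset ?_) ?_
  · rintro _ ⟨p, hp, rfl⟩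
    exact hp
  · rintro ⟨k, I, a⟩ _ ⟨k', I', a'⟩ _ heq
    simp only [Prod.mk.injEq] at heq
    have h1 := lift_injective h hΔ hΓ (a₁ := (k, a)) (a₂ := (k', a')) heq.1
    rw [Prod.mk.injEq] at h1
    rw [h1.1, h1.2, Finset.map_injective _ heq.2]

theorem bVal_term_finite' {q : ℕ} (h : IsVertexDeletion Γ Δ v ι) (hΔ : Δ.Nondegenerate)
    (hΓ : Γ.Nondegenerate) (φ : Δ.Cochain q) (k : Γ.Char) (I : Finset J) :
    (Function.support fun a : {a : ℤ // a ≡ Δ.e v [ZMOD 2]} =>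
      ev φ (lift h hΔ k a) (I.map ι.toEmbedding)).Finite := by
  refine Set.Finite.of_finite_image (f := fun a => (k, I, a))
    ((bVal_term_finite h hΔ hΓ φ).subset ?_) ?_
  · rintro _ ⟨a, ha, rfl⟩
    exact ha
  · intro a _ a' _ heq
    simpa using heq

theorem bVal_finite {q : ℕ} (h : IsVertexDeletion Γ Δ v ι) (hΔ : Δ.Nondegenerate)
    (hΓ : Γ.Nondegenerate) (ε : Γ.Char → ℤ → ℤ) (φ : Δ.Cochain q) :
    (Function.support fun c : Γ.Cube q => bVal h hΔ ε φ c.1.1 c.1.2).Finite := by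
  refine Set.Finite.of_finite_image (f := Subtype.val)
    (((bVal_term_finite h hΔ hΓ φ).image fun p => (p.1, p.2.1)).subset ?_)
    Subtype.val_injective.injOn
  rintro _ ⟨c, hc, rfl⟩
  obtain ⟨a, ha⟩ : ∃ a : {a : ℤ // a ≡ Δ.e v [ZMOD 2]}, ε c.1.1 a •
      ev φ (lift h hΔ c.1.1 a) (c.1.2.map ι.toEmbedding) ≠ 0 := by
    by_contra! hcon
    exact hc (finsum_eq_zero_of_forall_eq_zero hcon)
  exact ⟨(c.1.1, c.1.2, a), right_ne_zero_of_smul ha, rfl⟩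

theorem smul_support_finite {ι' : Type*} {f : ι' → Tower} (hf : (Function.support f).Finite)
    (n : ι' → ℤ) : (Function.support fun a => n a • f a).Finite :=
  hf.subset fun _ ha => right_ne_zero_of_smul ha

/-- The dual operator `ℱ^q(Δ) → ℱ^q(Γ)` of
`(k, I) ↦ ∑_{a ≡ e_v (mod 2)} ε(k, a) (b(k) + a E_v^*, I)`. -/
def bOp (h : IsVertexDeletion Γ Δ v ι) (hΔ : Δ.Nondegenerate) (hΓ : Γ.Nondegenerate)
    (ε : Γ.Char → ℤ → ℤ) (q : ℕ) : Δ.Cochain q →ₗ[ℤ[X]] Γ.Cochain q where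
  toFun φ := Finsupp.ofSupportFinite (fun c => bVal h hΔ ε φ c.1.1 c.1.2)
    (bVal_finite h hΔ hΓ ε φ)
  map_add' φ ψ := by
    ext c
    simp only [Finsupp.ofSupportFinite_coe, Finsupp.coe_add, Pi.add_apply, bVal, ev_add, smul_add]
    exact finsum_add_distrib (smul_support_finite (bVal_term_finite' h hΔ hΓ φ _ _) _)
      (smul_support_finite (bVal_term_finite' h hΔ hΓ ψ _ _) _)
  map_smul' p φ := by
    ext c
    simp only [Finsupp.ofSupportFinite_coe, Finsupp.coe_smul, Pi.smul_apply, bVal, ev_smul,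
      RingHom.id_apply]
    rw [smul_finsum' p (smul_support_finite (bVal_term_finite' h hΔ hΓ φ _ _) _)]
    exact finsum_congr fun a => smul_comm _ _ _

theorem EI_map_pairing (h : IsVertexDeletion Γ Δ v ι) (I : Finset J) :
    Δ.pairing (EI (I.map ι.toEmbedding)) (EI (I.map ι.toEmbedding)) = Γ.pairing (EI I) (EI I) := by
  simp only [EI, Finset.sum_map, map_sum, LinearMap.sum_apply, pairing_E_E]
  refine Finset.sum_congr rfl fun i _ => Finset.sum_congr rfl fun j _ => ?_
  exact congrArg _ (h.form_eq _ _)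

theorem weight_map (h : IsVertexDeletion Γ Δ v ι) {K : V → ℚ} {k : J → ℚ}
    (hK : ∀ j, Δ.pairing K (E (ι j)) = Γ.pairing k (E j)) (I : Finset J) :
    Δ.weight (K + (2 : ℚ) • EI (I.map ι.toEmbedding)) =
      Γ.weight (k + (2 : ℚ) • EI I) + (Δ.weight K - Γ.weight k) := by
  have h1 : Δ.pairing K (EI (I.map ι.toEmbedding)) = Γ.pairing k (EI I) := by
    simp only [EI, Finset.sum_map, map_sum]
    exact Finset.sum_congr rfl fun j _ => hK j
  rw [weight_add, weight_add, chi, chi, map_add, map_add, LinearMap.add_apply,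
    LinearMap.add_apply, EI_map_pairing h, h1]
  ring

theorem cubeWeight_map (h : IsVertexDeletion Γ Δ v ι) {K : V → ℚ} {k : J → ℚ}
    (hK : ∀ j, Δ.pairing K (E (ι j)) = Γ.pairing k (E j)) (I : Finset J) :
    Δ.cubeWeight K (I.map ι.toEmbedding) =
      Γ.cubeWeight k I + (Δ.weight K - Γ.weight k) := by
  apply le_antisymm
  · refine Finset.sup'_le _ _ fun I' hI' => ?_
    obtain ⟨I₀, hI₀, rfl⟩ := Finset.subset_map_iff.1 (Finset.mem_powerset.1 hI')
    rw [weight_map h hK]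
    gcongr
    exact Finset.le_sup' (fun I' => Γ.weight (k + (2 : ℚ) • EI I')) (Finset.mem_powerset.2 hI₀)
  · rw [← le_sub_iff_add_le]
    refine Finset.sup'_le _ _ fun I' hI' => ?_
    rw [le_sub_iff_add_le, ← weight_map h hK]
    exact Finset.le_sup' (fun I' => Δ.weight (K + (2 : ℚ) • EI I'))
      (Finset.mem_powerset.2 (Finset.map_subset_map.2 (Finset.mem_powerset.1 hI')))

theorem sgn_map (ι : J ↪o V) (I : Finset J) (j : J) :
    sgn (I.map ι.toEmbedding) (ι j) = sgn I j := by
  rw [sgn, sgn, Finset.filter_map, Finset.card_map]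
  congr 3
  ext i
  simp

/-- The translation `a ↦ a + 2c` of the set of `a ≡ e (mod 2)`. -/
def parityShift (e c : ℤ) : {a : ℤ // a ≡ e [ZMOD 2]} ≃ {a : ℤ // a ≡ e [ZMOD 2]} where
  toFun a := ⟨a + 2 * c, by have := a.2; unfold Int.ModEq at *; omega⟩
  invFun a := ⟨a - 2 * c, by have := a.2; unfold Int.ModEq at *; omega⟩
  left_inv a := by ext; simp
  right_inv a := by ext; simp

theorem lift_shift (h : IsVertexDeletion Γ Δ v ι) (hΔ : Δ.Nondegenerate) (k : Γ.Char) (j : J)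
    (a : {a : ℤ // a ≡ Δ.e v [ZMOD 2]}) :
    lift h hΔ (Γ.shift k j) a =
      Δ.shift (lift h hΔ k (parityShift _ (Δ.form (ι j) v) a)) (ι j) := by
  refine Subtype.ext (hΔ.ext fun x => ?_)
  simp only [lift, shift, parityShift, Equiv.coe_fn_mk]
  rw [map_add _ (bMap _ _ _ _ + _), LinearMap.add_apply]
  rcases h.cases x with rfl | ⟨i, rfl⟩
  · rw [pairing_lift_v h hΔ, pairing_lift_v h hΔ, map_smul, LinearMap.smul_apply, pairing_E_E]
    push_cast [smul_eq_mul]; ring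
  · rw [pairing_lift_ι h hΔ, pairing_lift_ι h hΔ, map_add, LinearMap.add_apply, map_smul,
      LinearMap.smul_apply, map_smul, LinearMap.smul_apply, pairing_E_E, pairing_E_E, h.form_eq]

theorem bOp_comm (h : IsVertexDeletion Γ Δ v ι) (hΔ : Δ.Nondegenerate) (hΓ : Γ.Nondegenerate)
    (ε : Γ.Char → ℤ → ℤ)
    (hε : ∀ k j (a : ℤ), ε (Γ.shift k j) a = ε k (a + 2 * Δ.form (ι j) v))
    (q : ℕ) (φ : Δ.Cochain q) :
    Γ.delta q (bOp h hΔ hΓ ε q φ) = bOp h hΔ hΓ ε (q + 1) (Δ.delta q φ) := by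
  ext ⟨⟨k, I⟩, hI⟩
  change deltaVal (bOp h hΔ hΓ ε q φ) k I = bVal h hΔ ε (Δ.delta q φ) k I
  replace hI : I.card = q + 1 := hI
  have hfin := bVal_term_finite' h hΔ hΓ φ
  have hev : ∀ k {I : Finset J}, I.card = q → ev (bOp h hΔ hΓ ε q φ) k I = bVal h hΔ ε φ k I := by
    intro k I hI
    rw [ev, dif_pos hI]; rfl
  have hw : ∀ k a (I : Finset J), Δ.cubeWeight (lift h hΔ k a) (I.map ι.toEmbedding) =
      Γ.cubeWeight k I + (Δ.weight (lift h hΔ k a) - Γ.weight k) := fun k a I =>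
    cubeWeight_map h (fun j => pairing_lift_ι h hΔ k a j) I
  have hw' : ∀ k a j (I : Finset J),
      Δ.cubeWeight (Δ.shift (lift h hΔ k a) (ι j)) (I.map ι.toEmbedding) =
      Γ.cubeWeight (Γ.shift k j) I + (Δ.weight (lift h hΔ k a) - Γ.weight k) := by
    intro k a j I
    have e1 := lift_shift h hΔ k j ((parityShift _ (Δ.form (ι j) v)).symm a)
    rw [Equiv.apply_symm_apply] at e1
    rw [← e1, hw, e1]
    have e2 := weight_map h (K := lift h hΔ k a) (k := k)
      (fun j => pairing_lift_ι h hΔ k a j) {j}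
    simp only [EI, Finset.map_singleton, Finset.sum_singleton] at e2
    change Δ.weight (Δ.shift (lift h hΔ k a) (ι j)) = Γ.weight (Γ.shift k j) + _ at e2
    rw [e2]; ring
  have hd : ∀ a, ev (Δ.delta q φ) (lift h hΔ k a) (I.map ι.toEmbedding) = ∑ j ∈ I, sgn I j •
      (Upow (Γ.cubeWeight k I - Γ.cubeWeight k (I.erase j)) •
          ev φ (lift h hΔ k a) ((I.erase j).map ι.toEmbedding) -
        Upow (Γ.cubeWeight k I - Γ.cubeWeight (Γ.shift k j) (I.erase j)) •
          ev φ (Δ.shift (lift h hΔ k a) (ι j)) ((I.erase j).map ι.toEmbedding)) := by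
    intro a
    rw [ev_delta _ _ (by rw [Finset.card_map, hI]), deltaVal, Finset.sum_map]
    refine Finset.sum_congr rfl fun j _ => ?_
    rw [← Finset.map_erase]
    change sgn (I.map ι.toEmbedding) (ι j) • (_ - Upow (_ -
      Δ.cubeWeight (Δ.shift (lift h hΔ k a) (ι j)) _) • _) = _
    rw [sgn_map, hw, hw, hw', add_sub_add_right_eq_sub, add_sub_add_right_eq_sub]
    rfl
  have hsh : ∀ j (I' : Finset J), (fun a : {a : ℤ // a ≡ Δ.e v [ZMOD 2]} => ε (Γ.shift k j) a •
      ev φ (lift h hΔ (Γ.shift k j) a) (I'.map ι.toEmbedding)) =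
      fun a => (fun a' : {a : ℤ // a ≡ Δ.e v [ZMOD 2]} => ε k a' •
        ev φ (Δ.shift (lift h hΔ k a') (ι j)) (I'.map ι.toEmbedding))
        (parityShift _ (Δ.form (ι j) v) a) := by
    intro j I'
    funext a
    simp only [lift_shift, hε]
    rfl
  have hfin2 : ∀ j (I' : Finset J), (Function.support fun a : {a : ℤ // a ≡ Δ.e v [ZMOD 2]} => ε k a •
        ev φ (Δ.shift (lift h hΔ k a) (ι j)) (I'.map ι.toEmbedding)).Finite := by
    intro j I'
    have h1 := smul_support_finite (hfin (Γ.shift k j) I') (fun a => ε (Γ.shift k j) a)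
    rw [hsh] at h1
    have h2 := h1.image (parityShift _ (Δ.form (ι j) v))
    refine h2.subset fun a ha => ⟨(parityShift _ (Δ.form (ι j) v)).symm a, ?_, by simp⟩
    simpa using ha
  have hfin1 : ∀ (I' : Finset J), (Function.support fun a : {a : ℤ // a ≡ Δ.e v [ZMOD 2]} => ε k a •
        ev φ (lift h hΔ k a) (I'.map ι.toEmbedding)).Finite := fun I' =>
    smul_support_finite (hfin k I') _
  rw [deltaVal, bVal]
  simp only [hd, Finset.smul_sum]
  rw [finsum_sum_comm]
  · refine Finset.sum_congr rfl fun j hj => ?_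
    have hc : (I.erase j).card = q := by rw [Finset.card_erase_of_mem hj, hI]; rfl
    have hre : bVal h hΔ ε φ (Γ.shift k j) (I.erase j) =
        ∑ᶠ a : {a : ℤ // a ≡ Δ.e v [ZMOD 2]}, ε k a •
          ev φ (Δ.shift (lift h hΔ k a) (ι j)) ((I.erase j).map ι.toEmbedding) := by
      rw [bVal, hsh]
      exact finsum_comp_equiv (parityShift _ (Δ.form (ι j) v))
        (f := fun a' : {a : ℤ // a ≡ Δ.e v [ZMOD 2]} => ε k a' •
          ev φ (Δ.shift (lift h hΔ k a') (ι j)) ((I.erase j).map ι.toEmbedding))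
    rw [hev _ hc, hev _ hc, hre, bVal,
      smul_finsum' _ (hfin1 _), smul_finsum' _ (hfin2 _ _),
      ← finsum_sub_distrib, smul_finsum']
    · refine finsum_congr fun a => ?_
      simp only [smul_sub, smul_comm (ε k a)]
    · refine ((hfin1 (I.erase j)).union (hfin2 j (I.erase j))).subset fun a ha => ?_
      by_contra hcon
      rw [Set.mem_union, not_or] at hcon
      simp only [Function.mem_support, not_not] at hcon
      exact ha (by simp only [hcon.1, hcon.2, smul_zero, sub_zero])
    · exact (hfin1 _).subset fun a ha => right_ne_zero_of_smul ha
    · exact (hfin2 _ _).subset fun a ha => right_ne_zero_of_smul ha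
  · intro j _
    refine ((hfin1 (I.erase j)).union (hfin2 j (I.erase j))).subset fun a ha => ?_
    by_contra hcon
    rw [Set.mem_union, not_or] at hcon
    simp only [Function.mem_support, not_not] at hcon
    refine ha ?_
    simp only [smul_comm (ε k a), smul_sub, hcon.1, hcon.2, smul_zero, sub_zero]

/-- The morphism of complexes `B^* : ℱ^*(Δ) → ℱ^*(Γ)`, dual to
`B_q((k, I)) = ∑_{a ≡ e_v (mod 2)} (b(k) + a E_v^*, I)`. -/
def Bhom (h : IsVertexDeletion Γ Δ v ι) (hΔ : Δ.Nondegenerate) (hΓ : Γ.Nondegenerate) :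
    Δ.latticeComplex ⟶ Γ.latticeComplex :=
  complexHom (bOp h hΔ hΓ fun _ _ => 1) (bOp_comm h hΔ hΓ _ fun _ _ _ => rfl)

/-- `n(k, a) = (k - r_{[k]}, R(E_v)) + a + e_v`, an even integer. -/
def nVal (Γ : PlumbingGraph J) (Δ : PlumbingGraph V) (v : V) (ι : J ↪o V) (r : Γ.OrbitRep)
    (k : Γ.Char) (a : ℤ) : ℚ :=
  Γ.pairing ((k : J → ℚ) - (r.rep (Quotient.mk Γ.orbitSetoid k) : J → ℚ))
    (resMap Γ Δ ι (E v)) + a + Δ.e v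

/-- The sign `(-1)^{n(k, a) / 2}`. -/
def Bsign (Γ : PlumbingGraph J) (Δ : PlumbingGraph V) (v : V) (ι : J ↪o V) (r : Γ.OrbitRep)
    (k : Γ.Char) (a : ℤ) : ℤ :=
  (Int.negOnePow ⌊nVal Γ Δ v ι r k a / 2⌋ : ℤˣ)

theorem Bsign_shift (hΓ : Γ.Nondegenerate) (r : Γ.OrbitRep)
    (k : Γ.Char) (j : J) (a : ℤ) :
    Bsign Γ Δ v ι r (Γ.shift k j) a = Bsign Γ Δ v ι r k (a + 2 * Δ.form (ι j) v) := by
  have h1 : Quotient.mk Γ.orbitSetoid (Γ.shift k j) = Quotient.mk Γ.orbitSetoid k := by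
    refine Quotient.sound (Γ.orbitSetoid.symm' ?_)
    exact ⟨Pi.single j 1, by rw [lat_single]; rfl⟩
  have h2 : Γ.pairing (E j) (resMap Γ Δ ι (E v)) = Δ.form (ι j) v := by
    rw [Γ.pairing_comm]
    simp only [resMap, map_sum, map_smul, LinearMap.sum_apply, LinearMap.smul_apply,
      hΓ.pairing_Edual, pairing_E_E]
    rw [Finset.sum_eq_single j]
    · simp [form_symm Δ v]
    · intro i _ hi; simp [hi.symm]
    · simp
  have h3 : nVal Γ Δ v ι r (Γ.shift k j) a = nVal Γ Δ v ι r k (a + 2 * Δ.form (ι j) v) := by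
    simp only [nVal, h1]
    change Γ.pairing ((k : J → ℚ) + (2 : ℚ) • E j - _) _ + _ + _ = _
    rw [add_sub_right_comm, map_add, LinearMap.add_apply, map_smul, LinearMap.smul_apply, h2,
      smul_eq_mul]
    push_cast; ring
  rw [Bsign, Bsign, h3]

/-- The sign-modified morphism of complexes `B̄^* : ℱ^*(Δ) → ℱ^*(Γ)`, dual to
`B̄_q((k, I)) = ∑_{a ≡ e_v (mod 2)} (-1)^{n(k, a) / 2} (b(k) + a E_v^*, I)`. -/
def Bbarhom (h : IsVertexDeletion Γ Δ v ι) (hΔ : Δ.Nondegenerate) (hΓ : Γ.Nondegenerate)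
    (r : Γ.OrbitRep) : Δ.latticeComplex ⟶ Γ.latticeComplex :=
  complexHom (bOp h hΔ hΓ (Bsign Γ Δ v ι r))
    (bOp_comm h hΔ hΓ _ fun k j a => Bsign_shift hΓ r k j a)

end Deletion

section Surgery

variable {J : Type u} [Fintype J] [LinearOrder J]

/-- The graph `Γ ∖ j₀`: the vertex `j₀` and its adjacent edges are deleted. -/
def delete (Γ : PlumbingGraph J) (j₀ : J) : PlumbingGraph {j : J // j ≠ j₀} where
  graph := Γ.graph.comap Subtype.val
  e j := Γ.e j

/-- The decoration of the vertex `j₀` is modified from `e_{j₀}` to `e_{j₀} + m`. -/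
def addDecoration (Γ : PlumbingGraph J) (j₀ : J) (m : ℤ) : PlumbingGraph J where
  graph := Γ.graph
  e := Function.update Γ.e j₀ (Γ.e j₀ + m)

/-- The graph `Γ_{j₀}^+`: the decoration `e_{j₀}` is replaced by `e_{j₀} + 1`. -/
def plus (Γ : PlumbingGraph J) (j₀ : J) : PlumbingGraph J := Γ.addDecoration j₀ 1

/-- The graph `Γ^b`: a new vertex `j_new = ⊤` with decoration `-1` is attached to `j₀` by a single
new edge. The new vertex is the largest one in the ordering of the vertices. -/
def attach (Γ : PlumbingGraph J) (j₀ : J) : PlumbingGraph (WithTop J) where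
  graph := Γ.graph.map (WithTop.some : J → WithTop J) ⊔ SimpleGraph.edge (j₀ : WithTop J) ⊤
  e := WithTop.recTopCoe (-1) Γ.e

/-- The blow-up of `Γ` at the vertex `j₀`: a new vertex with decoration `-1` is attached to `j₀`,
and the decoration `e_{j₀}` is replaced by `e_{j₀} - 1`. -/
def blowUp (Γ : PlumbingGraph J) (j₀ : J) : PlumbingGraph (WithTop J) :=
  (Γ.addDecoration j₀ (-1)).attach j₀

theorem blowUp_plus (Γ : PlumbingGraph J) (j₀ : J) : Γ.attach j₀ = (Γ.plus j₀).blowUp j₀ := by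
  simp [blowUp, plus, addDecoration]

theorem delete_isVertexDeletion (Γ : PlumbingGraph J) (j₀ : J) :
    IsVertexDeletion (Γ.delete j₀) Γ j₀ (OrderEmbedding.subtype (· ≠ j₀)) where
  range_eq := by ext; simp
  graph_eq := rfl
  e_eq _ := rfl

theorem attach_adj_coe (Γ : PlumbingGraph J) (j₀ i j : J) :
    (Γ.attach j₀).graph.Adj i j ↔ Γ.graph.Adj i j := by
  simp only [attach, SimpleGraph.sup_adj, SimpleGraph.edge_adj]
  constructor
  · rintro (⟨-, a, b, hab, ha, hb⟩ | h)
    · rw [WithTop.coe_inj] at ha hb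
      subst ha hb
      exact hab
    · simp at h
  · intro h
    exact Or.inl ⟨by simpa using h.ne, i, j, h, rfl, rfl⟩

theorem attach_adj_top (Γ : PlumbingGraph J) (j₀ i : J) :
    (Γ.attach j₀).graph.Adj i ⊤ ↔ i = j₀ := by
  simp only [attach, SimpleGraph.sup_adj, SimpleGraph.edge_adj]
  constructor
  · rintro (⟨-, a, b, -, -, hb⟩ | h)
    · exact absurd hb WithTop.coe_ne_top
    · simpa using h
  · rintro rfl
    exact Or.inr (by simp)

theorem attach_isVertexDeletion (Γ : PlumbingGraph J) (j₀ : J) :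
    IsVertexDeletion Γ (Γ.attach j₀) ⊤ WithTop.coeOrderHom where
  range_eq := by ext x; induction x <;> simp
  graph_eq := by
    ext i j
    exact (attach_adj_coe Γ j₀ i j).symm
  e_eq _ := rfl

theorem attach_form_coe (Γ : PlumbingGraph J) (j₀ i j : J) :
    (Γ.attach j₀).form i j = Γ.form i j :=
  (attach_isVertexDeletion Γ j₀).form_eq i j

theorem attach_form_top (Γ : PlumbingGraph J) (j₀ i : J) :
    (Γ.attach j₀).form i ⊤ = if i = j₀ then 1 else 0 := by
  split_ifs with h
  · exact form_of_adj _ ((attach_adj_top Γ j₀ i).2 h)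
  · exact form_of_not_adj _ (WithTop.coe_ne_top) fun h' => h ((attach_adj_top Γ j₀ i).1 h')

theorem attach_form_top_top (Γ : PlumbingGraph J) (j₀ : J) : (Γ.attach j₀).form ⊤ ⊤ = -1 :=
  form_self _ _

theorem addDecoration_form (Γ : PlumbingGraph J) (j₀ : J) (m : ℤ) (i j : J) :
    (Γ.addDecoration j₀ m).form i j = Γ.form i j + if i = j₀ then (if j = j₀ then m else 0) else 0 := by
  by_cases hij : i = j
  · subst hij
    rw [form_self, form_self]
    by_cases h : i = j₀
    · subst h; simp [addDecoration]
    · simp [addDecoration, h]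
  · have h0 : (if i = j₀ then (if j = j₀ then m else 0) else 0) = 0 := by
      split_ifs with h1 h2
      · exact absurd (h1.trans h2.symm) hij
      · rfl
      · rfl
    rw [h0, add_zero]
    by_cases ha : Γ.graph.Adj i j
    · rw [form_of_adj Γ ha, form_of_adj (Γ.addDecoration j₀ m) ha]
    · rw [form_of_not_adj Γ hij ha, form_of_not_adj (Γ.addDecoration j₀ m) hij ha]

theorem sum_withTop (f : WithTop J → ℚ) : ∑ x, f x = f ⊤ + ∑ j : J, f j :=
  Fintype.sum_option f

/-- The extension over `ℚ` of the map `π_* : ∑ x_j E_j + x_new E_new ↦ ∑ x_j E_j`. -/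
def piStar (x : WithTop J → ℚ) : J → ℚ := fun j => x j

theorem attach_pairing (Γ : PlumbingGraph J) (j₀ : J) (x y : WithTop J → ℚ) :
    (Γ.attach j₀).pairing x y = Γ.pairing (piStar x) (piStar y)
      + x ⊤ * y j₀ + x j₀ * y ⊤ - x ⊤ * y ⊤ := by
  rw [pairing_apply, pairing_apply, sum_withTop]
  simp only [sum_withTop, attach_form_coe, attach_form_top, attach_form_top_top,
    form_symm (Γ.attach j₀) ⊤ (WithTop.some _), Finset.sum_add_distrib, piStar]
  simp
  ring

theorem addDecoration_pairing (Γ : PlumbingGraph J) (j₀ : J) (m : ℤ) (x y : J → ℚ) :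
    (Γ.addDecoration j₀ m).pairing x y = Γ.pairing x y + m * x j₀ * y j₀ := by
  rw [pairing_apply, pairing_apply]
  simp only [addDecoration_form, Int.cast_add, mul_add, add_mul, Finset.sum_add_distrib]
  congr 1
  rw [Finset.sum_eq_single j₀, Finset.sum_eq_single j₀]
  · rw [if_pos rfl, if_pos rfl]; ring
  · simp +contextual
  · simp
  · simp +contextual
  · simp

theorem blowUp_pairing (Γ : PlumbingGraph J) (j₀ : J) (x y : WithTop J → ℚ) :
    (Γ.blowUp j₀).pairing x y = Γ.pairing (piStar x) (piStar y)
      - (x ⊤ - x j₀) * (y ⊤ - y j₀) := by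
  rw [blowUp, attach_pairing, addDecoration_pairing]
  simp only [piStar]
  push_cast; ring

/-- If `Γ_{j₀}^+` is non-degenerate then so is its blow-up `Γ^b`. -/
theorem attach_nondegenerate {Γ : PlumbingGraph J} {j₀ : J} (h : (Γ.plus j₀).Nondegenerate) :
    (Γ.attach j₀).Nondegenerate := by
  intro hdet
  have hdet' : (Γ.attach j₀).formQ.det = 0 := by
    have := Int.cast_det (R := ℚ) (Γ.attach j₀).form
    rw [hdet, Int.cast_zero] at this
    exact this.symm
  obtain ⟨x, hx, hx0⟩ := Matrix.exists_vecMul_eq_zero_iff.2 hdet'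
  have hp : ∀ j, (Γ.attach j₀).pairing x (E j) = 0 := by
    intro j
    have := congrFun hx0 j
    rw [pairing_E]
    simpa [Matrix.vecMul, dotProduct, formQ] using this
  rw [blowUp_plus] at hp
  have htop : x ⊤ - x j₀ = 0 := by
    have := hp ⊤
    rw [blowUp_pairing] at this
    have e1 : piStar (E (⊤ : WithTop J)) = 0 := by ext j; simp [piStar, E]
    rw [e1] at this
    have h' : x j₀ - x ⊤ = 0 := by simpa [E] using this
    linarith
  have hpi : piStar x = 0 := h.ext fun j => by
    have := hp j
    rw [blowUp_pairing, htop, zero_mul, sub_zero] at this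
    have e1 : piStar (E (j : WithTop J)) = E j := by
      ext i
      by_cases hij : i = j
      · subst hij; simp [piStar, E]
      · simp [piStar, E, hij]
    rw [e1] at this
    rw [this]; simp
  apply hx
  ext y
  induction y with
  | top => have := congrFun hpi j₀; simp only [piStar, Pi.zero_apply] at this ⊢; linarith
  | coe j => exact congrFun hpi j

end Surgery

section BlowDown

variable {J : Type u} [Fintype J] [LinearOrder J] {Γ : PlumbingGraph J}
  {Γ' : PlumbingGraph (WithTop J)} {j₀ : J}

theorem piStar_E_coe (j : J) : piStar (E (j : WithTop J)) = E j := by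
  ext i
  by_cases hij : i = j
  · subst hij; simp [piStar, E]
  · simp [piStar, E, hij]

theorem piStar_E_top : piStar (E (⊤ : WithTop J)) = 0 := by ext j; simp [piStar, E]

theorem piStar_mem (h : Γ' = Γ.blowUp j₀) {k : WithTop J → ℚ} (hk : k ∈ Γ'.Char) :
    piStar k ∈ Γ.Char := by
  subst h
  have key : ∀ (x : WithTop J → ℚ) (l : J → ℤ), (Γ.blowUp j₀).pairing x
      (lat (WithTop.recTopCoe (l j₀) l)) = Γ.pairing (piStar x) (lat l) := by
    intro x l
    rw [blowUp_pairing]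
    have e1 : piStar (lat (WithTop.recTopCoe (l j₀) l)) = lat l := rfl
    rw [e1]
    simp [lat]
  refine ⟨fun l => ?_, fun l => ?_⟩
  · obtain ⟨n, hn⟩ := hk.1 (WithTop.recTopCoe (l j₀) l)
    exact ⟨n, by rw [← hn, key]⟩
  · obtain ⟨n, hn⟩ := hk.2 (WithTop.recTopCoe (l j₀) l)
    refine ⟨n, ?_⟩
    rw [← hn, chi, chi, key]
    rfl

/-- `π_* : Char(Γ') → Char(Γ)`, where `Γ'` is the blow-up of `Γ` at `j₀`. -/
def piChar (h : Γ' = Γ.blowUp j₀) (k : Γ'.Char) : Γ.Char := ⟨piStar k, piStar_mem h k.2⟩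

/-- The subset `I ∩ J` of `J`, for a set `I` of vertices of `Γ'`. -/
def down (I : Finset (WithTop J)) : Finset J :=
  I.preimage WithTop.some WithTop.coe_injective.injOn

/-- The inclusion of the vertices of `Γ` in those of `Γ'`. -/
abbrev up (I : Finset J) : Finset (WithTop J) := I.map WithTop.coeOrderHom.toEmbedding

/-- The value at the cube `(k, I)` of `Γ'` of the cochain `π_*^c φ = φ ∘ π_*^h`, where
`π_*^h((k, I)) = U^{w'(k, I) - w(π_* k, I)} (π_* k, I)` if `j_new ∉ I` and `0` otherwise. -/
def piVal {q : ℕ} (h : Γ' = Γ.blowUp j₀) (φ : Γ.Cochain q) (k : Γ'.Char)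
    (I : Finset (WithTop J)) : Tower :=
  if ⊤ ∈ I then 0 else
    Upow (Γ'.cubeWeight k I - Γ.cubeWeight (piChar h k) (down I)) • ev φ (piChar h k) (down I)

theorem down_up (I : Finset J) : down (up I) = I := by
  ext j; simp [down, up]

theorem top_notMem_up (I : Finset J) : ⊤ ∉ up I := by simp [up]

theorem exists_up {I : Finset (WithTop J)} (hI : ⊤ ∉ I) : ∃ I₀, I = up I₀ := by
  refine ⟨down I, ?_⟩
  ext x
  induction x with
  | top => simp [hI, up]
  | coe j => simp [up, down]

theorem weight_piStar (h : Γ' = Γ.blowUp j₀) (k : WithTop J → ℚ) :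
    Γ'.weight k = Γ.weight (piStar k) + ((k ⊤ - k j₀) ^ 2 - 1) / 8 := by
  subst h
  have : Fintype.card (WithTop J) = Fintype.card J + 1 := Fintype.card_option
  rw [weight, weight, blowUp_pairing, this]
  push_cast; ring

/-- For `k ∈ Char(Γ')` one has `k = π^* π_* k + a E_new` with an odd integer `a`. -/
theorem piStar_odd (h : Γ' = Γ.blowUp j₀) {k : WithTop J → ℚ} (hk : k ∈ Γ'.Char) :
    ∃ n : ℤ, k ⊤ - k j₀ = 2 * n + 1 := by
  obtain ⟨n, hn⟩ := (mem_Char_iff _ _).1 hk ⊤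
  have he : Γ'.e ⊤ = -1 := by subst h; rfl
  have hp : Γ'.pairing k (E ⊤) = -(k ⊤ - k j₀) := by
    subst h
    rw [blowUp_pairing, piStar_E_top]
    simp [E]
  rw [hp, he] at hn
  exact ⟨-n, by push_cast at hn ⊢; linarith⟩

theorem piStar_vertex (k : WithTop J → ℚ) (I : Finset J) :
    piStar (k + (2 : ℚ) • EI (up I)) = piStar k + (2 : ℚ) • EI I := by
  have : piStar (EI (up I)) = EI I := by
    ext j
    simp only [EI, Finset.sum_map, piStar, Finset.sum_apply]
    exact Finset.sum_congr rfl fun i _ => congrFun (piStar_E_coe i) j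
  rw [← this]; rfl

theorem odd_vertex (k : WithTop J → ℚ) (I : Finset J) :
    (k + (2 : ℚ) • EI (up I)) ⊤ - (k + (2 : ℚ) • EI (up I)) j₀ =
      k ⊤ - k j₀ - if j₀ ∈ I then 2 else 0 := by
  have h1 : EI (up I) ⊤ = 0 := by
    simp [EI, E, Finset.sum_apply, Pi.single_apply]
  have h2 : EI (up I) j₀ = if j₀ ∈ I then 1 else 0 := by
    simp [EI, E, Finset.sum_apply, Pi.single_apply]
  simp only [Pi.add_apply, Pi.smul_apply, h1, h2, smul_eq_mul]
  split_ifs <;> ring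

theorem pi_exp_ge (h : Γ' = Γ.blowUp j₀) (k : WithTop J → ℚ) (I : Finset J) :
    ∃ d : ℤ, (d = 0 ∨ d = 1) ∧ ((k ⊤ - k j₀ - 2 * d) ^ 2 - 1) / 8 ≤
      Γ'.cubeWeight k (up I) - Γ.cubeWeight (piStar k) I := by
  obtain ⟨I', hI', hmax⟩ := Finset.exists_mem_eq_sup' (s := I.powerset)
    ⟨∅, Finset.empty_mem_powerset I⟩ fun I' => Γ.weight (piStar k + (2 : ℚ) • EI I')
  have h1 : Γ'.weight (k + (2 : ℚ) • EI (up I')) ≤ Γ'.cubeWeight k (up I) :=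
    Finset.le_sup' (fun I' => Γ'.weight (k + (2 : ℚ) • EI I'))
      (Finset.mem_powerset.2 (Finset.map_subset_map.2 (Finset.mem_powerset.1 hI')))
  have h2 : Γ.cubeWeight (piStar k) I = Γ.weight (piStar k + (2 : ℚ) • EI I') := hmax
  rw [weight_piStar h, piStar_vertex, odd_vertex] at h1
  by_cases hj : j₀ ∈ I'
  · refine ⟨1, Or.inr rfl, ?_⟩
    rw [if_pos hj] at h1
    rw [h2]; push_cast; linarith
  · refine ⟨0, Or.inl rfl, ?_⟩
    rw [if_neg hj] at h1
    rw [h2]; push_cast; linarith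

theorem pi_exp_nonneg (h : Γ' = Γ.blowUp j₀) (k : Γ'.Char) (I : Finset J) :
    0 ≤ Γ'.cubeWeight k (up I) - Γ.cubeWeight (piChar h k) I := by
  obtain ⟨d, -, hd⟩ := pi_exp_ge h k I
  obtain ⟨n, hn⟩ := piStar_odd h k.2
  refine le_trans ?_ hd
  rw [hn]
  have h1 : (1 : ℤ) ≤ (2 * n + 1 - 2 * d) ^ 2 := by
    have : 2 * n + 1 - 2 * d ≠ 0 := by omega
    have := pow_pos (abs_pos.2 this) 2
    rw [sq_abs] at this
    omega
  have h2 : (1 : ℚ) ≤ (2 * n + 1 - 2 * d) ^ 2 := by exact_mod_cast h1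
  linarith

theorem pi_exp_int (h : Γ' = Γ.blowUp j₀) (k : Γ'.Char) (I : Finset (WithTop J)) (I' : Finset J) :
    ∃ n : ℤ, Γ'.cubeWeight k I - Γ.cubeWeight (piChar h k) I' = n := by
  obtain ⟨a, ha⟩ := Γ'.cubeWeight_int k I
  obtain ⟨b, hb⟩ := Γ.cubeWeight_int (piChar h k) I'
  obtain ⟨n, hn⟩ := piStar_odd h k.2
  obtain ⟨m, hm⟩ := Int.even_mul_succ_self n
  refine ⟨a - b + m, ?_⟩
  rw [ha, hb, weight_piStar h, hn]
  have : (n : ℚ) * (n + 1) = m + m := by exact_mod_cast hm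
  simp only [piChar]
  push_cast
  linear_combination this / 2

theorem piVal_finite {q : ℕ} (h : Γ' = Γ.blowUp j₀) (φ : Γ.Cochain q) :
    (Function.support fun c : Γ'.Cube q => piVal h φ c.1.1 c.1.2).Finite := by
  obtain ⟨N, hN⟩ : ∃ N : ℕ, ∀ k I, ∀ n, N ≤ n → (X ^ n : ℤ[X]) • ev φ k I = 0 := by
    choose M hM using tower_torsion
    refine ⟨φ.support.sup fun c => M (φ c), fun k I n hn => ?_⟩
    unfold ev
    split_ifs with hc
    · by_cases h0 : φ ⟨(k, I), hc⟩ = 0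
      · rw [h0, smul_zero]
      · exact hM _ _ (le_trans (Finset.le_sup (f := fun c => M (φ c))
          (Finsupp.mem_support_iff.2 h0)) hn)
    · rw [smul_zero]
  let S : Set ((Γ.Char × Finset J) × ℚ) := {c | ev φ c.1 c.2 ≠ 0} ×ˢ
    ((fun n : ℤ => (n : ℚ)) '' Set.Icc (-(8 * N + 4 : ℤ)) (8 * N + 4))
  have hS : S.Finite := (ev_finite φ).prod ((Set.finite_Icc _ _).image _)
  refine Set.Finite.of_finite_image
    (f := fun c : Γ'.Cube q => ((piChar h c.1.1, down c.1.2), c.1.1.1 ⊤ - c.1.1.1 j₀))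
    (hS.subset ?_) ?_
  · rintro _ ⟨⟨⟨k, I⟩, hI⟩, hc, rfl⟩
    change piVal h φ k I ≠ 0 at hc
    unfold piVal at hc
    split_ifs at hc with htop
    · exact absurd rfl hc
    · refine ⟨right_ne_zero_of_smul hc, ?_⟩
      obtain ⟨I₀, rfl⟩ := exists_up htop
      rw [down_up] at hc
      obtain ⟨n, hn⟩ := piStar_odd h k.2
      refine ⟨2 * n + 1, ?_, by push_cast; exact hn.symm⟩
      obtain ⟨d, hd, hge⟩ := pi_exp_ge h k I₀
      have hlt : ⌊Γ'.cubeWeight k (up I₀) - Γ.cubeWeight (piChar h k) I₀⌋₊ < N := by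
        by_contra hcon
        exact hc (hN _ _ _ (not_lt.1 hcon))
      rw [Nat.floor_lt (pi_exp_nonneg h k I₀)] at hlt
      have h1 : ((2 * n + 1 - 2 * d : ℤ) : ℚ) ^ 2 < ((8 * N + 1 : ℤ) : ℚ) := by
        have := lt_of_le_of_lt hge hlt
        rw [hn] at this
        push_cast
        linarith
      have h2 : (2 * n + 1 - 2 * d) ^ 2 < (8 * N + 1 : ℤ) := by exact_mod_cast h1
      rw [Set.mem_Icc]
      constructor <;> rcases hd with rfl | rfl <;> nlinarith
  · rintro ⟨⟨k, I⟩, hI⟩ hc ⟨⟨k', I'⟩, hI'⟩ hc' heq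
    have ht : ∀ {k I}, piVal h φ k I ≠ 0 → ⊤ ∉ I := fun h1 h2 => h1 (by simp [piVal, h2])
    obtain ⟨I₀, rfl⟩ := exists_up (ht hc)
    obtain ⟨I₁, rfl⟩ := exists_up (ht hc')
    simp only [Prod.mk.injEq, down_up] at heq
    obtain ⟨⟨h1, rfl⟩, h2⟩ := heq
    have h1' := congrArg Subtype.val h1
    simp only [piChar] at h1'
    have : k = k' := by
      ext x
      induction x with
      | top =>
        have := congrFun h1' j₀
        simp only [piStar] at this
        linarith
      | coe j => exact congrFun h1' j
    subst this
    rfl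

/-- The dual operator `π_*^c : ℱ^q(Γ) → ℱ^q(Γ')`. -/
def piOp (h : Γ' = Γ.blowUp j₀) (q : ℕ) : Γ.Cochain q →ₗ[ℤ[X]] Γ'.Cochain q where
  toFun φ := Finsupp.ofSupportFinite (fun c => piVal h φ c.1.1 c.1.2) (piVal_finite h φ)
  map_add' φ ψ := by
    ext c
    simp only [Finsupp.ofSupportFinite_coe, Finsupp.coe_add, Pi.add_apply, piVal, ev_add, smul_add]
    split_ifs <;> simp
  map_smul' p φ := by
    ext c
    simp only [Finsupp.ofSupportFinite_coe, Finsupp.coe_smul, Pi.smul_apply, piVal, ev_smul,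
      RingHom.id_apply]
    split_ifs
    · simp
    · rw [smul_comm]

theorem piOp_comm (h : Γ' = Γ.blowUp j₀) (q : ℕ) (φ : Γ.Cochain q) :
    Γ'.delta q (piOp h q φ) = piOp h (q + 1) (Γ.delta q φ) := by
  ext ⟨⟨k, I⟩, hI⟩
  change deltaVal (piOp h q φ) k I = piVal h (Γ.delta q φ) k I
  replace hI : I.card = q + 1 := hI
  have hev : ∀ k {I : Finset (WithTop J)}, I.card = q →
      ev (piOp h q φ) k I = piVal h φ k I := by
    intro k I hI
    rw [ev, dif_pos hI]; rfl
  have hup : ∀ k (I₀ : Finset J), piVal h φ k (up I₀) =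
      Upow (Γ'.cubeWeight k (up I₀) - Γ.cubeWeight (piChar h k) I₀) •
        ev φ (piChar h k) I₀ := by
    intro k I₀
    rw [piVal, if_neg (top_notMem_up I₀), down_up]
  have hsc : ∀ j : J, piChar h (Γ'.shift k j) = Γ.shift (piChar h k) j := by
    intro j
    apply Subtype.ext
    simp only [piChar, shift]
    have : piStar ((k : WithTop J → ℚ) + (2 : ℚ) • E (j : WithTop J)) =
      piStar (k : WithTop J → ℚ) + (2 : ℚ) • piStar (E (j : WithTop J)) := rfl
    rw [this, piStar_E_coe]
  have hst : piChar h (Γ'.shift k ⊤) = piChar h k := by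
    apply Subtype.ext
    simp only [piChar, shift]
    have : piStar ((k : WithTop J → ℚ) + (2 : ℚ) • E ⊤) =
      piStar (k : WithTop J → ℚ) + (2 : ℚ) • piStar (E ⊤) := rfl
    rw [this, piStar_E_top, smul_zero, add_zero]
  have hsle : ∀ {I : Finset (WithTop J)} {x : WithTop J}, x ∈ I →
      0 ≤ Γ'.cubeWeight k I - Γ'.cubeWeight (Γ'.shift k x) (I.erase x) := fun hx =>
    sub_nonneg.2 (Γ'.cubeWeight_shift_erase_le _ hx)
  by_cases htop : ⊤ ∈ I
  · rw [piVal, if_pos htop, deltaVal, Finset.sum_eq_single ⊤]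
    · have hc : (I.erase ⊤).card = q := by rw [Finset.card_erase_of_mem htop, hI]; rfl
      obtain ⟨I₀, hI₀⟩ := exists_up (Finset.notMem_erase ⊤ I)
      have hn := hsle htop
      have hn' := sub_nonneg.2 (Γ'.cubeWeight_erase_le k I ⊤)
      rw [hev _ hc, hev _ hc]
      rw [hI₀] at hn hn' ⊢
      rw [hup, hup, ← mul_smul, ← mul_smul,
        Upow_mul hn' (pi_exp_nonneg h k I₀) (exp_int _ _ _),
        Upow_mul hn (pi_exp_nonneg h _ I₀) (exp_shift_int _ _ _ _), hst, sub_add_sub_cancel,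
        sub_add_sub_cancel, sub_self, smul_zero]
    · intro x hx hxt
      have hc : (I.erase x).card = q := by rw [Finset.card_erase_of_mem hx, hI]; rfl
      have ht : ⊤ ∈ I.erase x := Finset.mem_erase.2 ⟨hxt.symm, htop⟩
      rw [hev _ hc, hev _ hc, piVal, piVal, if_pos ht, if_pos ht]
      simp
    · exact fun hc => absurd htop hc
  · obtain ⟨I₀, rfl⟩ := exists_up htop
    have hI₀ : I₀.card = q + 1 := by rw [← hI, Finset.card_map]
    rw [piVal, if_neg htop, down_up, ev_delta _ _ hI₀, deltaVal, deltaVal, Finset.sum_map,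
      Finset.smul_sum]
    refine Finset.sum_congr rfl fun j hj => ?_
    have hj' : (j : WithTop J) ∈ up I₀ := Finset.mem_map_of_mem _ hj
    have he : (up I₀).erase (j : WithTop J) = up (I₀.erase j) :=
      (Finset.map_erase WithTop.coeOrderHom.toEmbedding I₀ j).symm
    have hc : (up (I₀.erase j)).card = q := by
      rw [Finset.card_map, Finset.card_erase_of_mem hj, hI₀]; rfl
    have hn := hsle hj'
    have hn' := sub_nonneg.2 (Γ'.cubeWeight_erase_le k (up I₀) j)
    have hm : 0 ≤ Γ.cubeWeight (piChar h k) I₀ -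
        Γ.cubeWeight (Γ.shift (piChar h k) j) (I₀.erase j) :=
      sub_nonneg.2 (Γ.cubeWeight_shift_erase_le _ hj)
    have hm' := sub_nonneg.2 (Γ.cubeWeight_erase_le (piChar h k) I₀ j)
    change sgn (up I₀) (WithTop.coeOrderHom j) • (Upow (_ - Γ'.cubeWeight k
      ((up I₀).erase (j : WithTop J))) • ev (piOp h q φ) k ((up I₀).erase (j : WithTop J)) -
      Upow (_ - Γ'.cubeWeight (Γ'.shift k j) ((up I₀).erase (j : WithTop J))) •
        ev (piOp h q φ) (Γ'.shift k j) ((up I₀).erase (j : WithTop J))) = _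
    rw [he] at hn hn' ⊢
    rw [sgn_map, hev _ hc, hev _ hc, hup, hup, smul_comm (Upow _) (sgn I₀ j)]
    congr 1
    rw [smul_sub, ← mul_smul, ← mul_smul, ← mul_smul, ← mul_smul,
      Upow_mul hn' (pi_exp_nonneg h k _) (exp_int _ _ _),
      Upow_mul hn (pi_exp_nonneg h _ _) (exp_shift_int _ _ _ _),
      Upow_mul (pi_exp_nonneg h k _) hm' (pi_exp_int h _ _ _),
      Upow_mul (pi_exp_nonneg h k _) hm (pi_exp_int h _ _ _), hsc]
    simp only [sub_add_sub_cancel]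

/-- The morphism of complexes `π_*^c : ℱ^*(Γ) → ℱ^*(Γ')` for the blow-up `Γ'` of `Γ` at `j₀`. -/
def piHom (h : Γ' = Γ.blowUp j₀) : Γ.latticeComplex ⟶ Γ'.latticeComplex :=
  complexHom (piOp h) (piOp_comm h)

end BlowDown

section Main

variable {J : Type u} [Fintype J] [LinearOrder J] (Γ : PlumbingGraph J) (j₀ : J)

/-- The morphism `A^* = B^* ∘ π_*^c : ℱ^*(Γ_{j₀}^+) → ℱ^*(Γ^b) → ℱ^*(Γ)`, where `Γ^b` is `Γ` with a
new `(-1)`-vertex attached to `j₀`: it is the blow-up of `Γ_{j₀}^+` at `j₀`, and `Γ = Γ^b ∖ j_new`. -/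
def Ahom (hplus : (Γ.plus j₀).Nondegenerate) (hΓ : Γ.Nondegenerate) :
    (Γ.plus j₀).latticeComplex ⟶ Γ.latticeComplex :=
  piHom (Γ.blowUp_plus j₀) ≫
    Bhom (Γ.attach_isVertexDeletion j₀) (attach_nondegenerate hplus) hΓ

/-- The morphism `B̄^* : ℱ^*(Γ) → ℱ^*(Γ ∖ j₀)`; it depends on the choice of a representative in
every orbit `k + 2L(Γ ∖ j₀)` of characteristic elements of `Γ ∖ j₀`. -/
def BbarDelete (hΓ : Γ.Nondegenerate) (hdel : (Γ.delete j₀).Nondegenerate)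
    (r : (Γ.delete j₀).OrbitRep) : Γ.latticeComplex ⟶ (Γ.delete j₀).latticeComplex :=
  Bbarhom (Γ.delete_isVertexDeletion j₀) hΓ hdel r

end Main


end PlumbingGraph

end

noncomputable section

open Polynomial LaurentPolynomial CategoryTheory

namespace PlumbingGraph

universe u

/-! ### Reduction to the kernel of `U`. -/

section Torsion

variable {M N P : Type*} [AddCommGroup M] [Module ℤ[X] M] [AddCommGroup N] [Module ℤ[X] N]
  [AddCommGroup P] [Module ℤ[X] P]

/-! The two maps commute with `δ` by construction, so only degreewise exactness is at stake. Every
cochain is killed by a power of `U`, and every cochain is divisible by `U`. Hence injectivity of `A`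
and exactness in the middle need only be checked on the kernel of `U`
(`injective_of_injective_on_ker`, `exact_of_exact_on_ker`). There a power `U^x` acts as zero for `x
≥ 1` and as the identity for `x = 0`, so `A` becomes a matrix of zeros and ones.

This matrix decomposes. Both `Γ` and its `+1` modification lose the same graph when `j₀` is deleted,
so the characteristic elements of each form lines indexed by `ℤ`, one for each characteristic
element `k` of `Γ ∖ j₀` (`line`, `exists_line`, `line_inj`). The map `A` preserves `k` and `I`, and
its entry from the point `s` to the point `d` is `U` to the power `lineExp` (`ev_aOp`). Put `n = s -
d`.

If `j₀ ∉ I`, the exponent is the triangular number `n(n+1)/2`, which vanishes only for `n = 0, -1`.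
On the kernel of `U` the generator at `s` therefore goes to the sum of the generators at `s` and `s
+ 1`. This is injective on finitely supported functions, and its cokernel is detected by the
alternating sum over the line, which is `B̄` up to a sign depending on `k`.

If `j₀ ∈ I`, the difference of the weights of the two faces in the direction of `j₀` is linear in
`s` with slope `1` (`exists_face_difference`), hence vanishes at exactly one integer `C`. The
generator at `C` goes to itself, and any other generator goes to its own copy plus that of the
neighbour closer to `C`. This triangular system is bijective, in agreement with the fact that `B̄`
does not see these cubes.

The identity `B̄ A = 0` holds before any restriction to the kernel of `U`: the reflection `n ↦ -n -
1` preserves triangular numbers and reverses the alternating sign (`Bbar_aOp`). The long sequence is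
then the homology sequence of the short exact sequence. -/

/-- A linear map on a module of `U`-power torsion is injective if it is injective on the kernel
of `U`. -/
theorem injective_of_injective_on_ker (f : M →ₗ[ℤ[X]] N)
    (hM : ∀ m : M, ∃ n : ℕ, (X ^ n : ℤ[X]) • m = 0)
    (hf : ∀ m : M, (X : ℤ[X]) • m = 0 → f m = 0 → m = 0) : Function.Injective f := by
  rw [injective_iff_map_eq_zero]
  intro m hm
  obtain ⟨n, hn⟩ := hM m
  induction n with
  | zero => simpa using hn
  | succ n ih =>
    -- The element `U^n m` lies in the kernel of `U` and of `f`, so it vanishes and a smaller power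
    -- of `U` already kills `m`.
    refine ih (hf _ ?_ ?_)
    · rw [← mul_smul, ← pow_succ']; exact hn
    · rw [map_smul, hm, smul_zero]

/-- Exactness at a module of `U`-power torsion can be checked on the kernel of `U`, if the source
of the first map is `U`-divisible. -/
theorem exact_of_exact_on_ker (f : M →ₗ[ℤ[X]] N) (g : N →ₗ[ℤ[X]] P) (hfg : ∀ m, g (f m) = 0)
    (hN : ∀ x : N, ∃ n : ℕ, (X ^ n : ℤ[X]) • x = 0)
    (hM : ∀ m : M, ∃ m' : M, (X : ℤ[X]) • m' = m)
    (hex : ∀ x : N, (X : ℤ[X]) • x = 0 → g x = 0 → ∃ m, f m = x) : Function.Exact f g := by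
  have hM' : ∀ (n : ℕ) (m : M), ∃ m' : M, (X ^ n : ℤ[X]) • m' = m := by
    intro n
    induction n with
    | zero => exact fun m => ⟨m, by simp⟩
    | succ n ih =>
      intro m
      obtain ⟨m₁, h₁⟩ := hM m
      obtain ⟨m₂, h₂⟩ := ih m₁
      exact ⟨m₂, by rw [pow_succ', mul_smul, h₂, h₁]⟩
  have key : ∀ (n : ℕ) (x : N), (X ^ n : ℤ[X]) • x = 0 → g x = 0 → ∃ m, f m = x := by
    intro n
    induction n with
    | zero => exact fun x hx _ => ⟨0, by simpa using hx.symm⟩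
    | succ n ih =>
      intro x hx hg
      obtain ⟨m, hm⟩ := hex ((X ^ n : ℤ[X]) • x) (by rw [← mul_smul, ← pow_succ']; exact hx)
        (by rw [map_smul, hg, smul_zero])
      -- Dividing the preimage of `U^n x` by `U^n` gives a correction `f m'` after which `U^n` kills
      -- the remainder.
      obtain ⟨m', hm'⟩ := hM' n m
      obtain ⟨m'', hm''⟩ := ih (x - f m') (by rw [smul_sub, ← map_smul, hm', hm, sub_self])
        (by rw [map_sub, hg, hfg, sub_zero])
      exact ⟨m' + m'', by rw [map_add, hm'', add_sub_cancel]⟩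
  intro x
  constructor
  · intro hg
    obtain ⟨n, hn⟩ := hN x
    exact key n x hn hg
  · rintro ⟨m, rfl⟩
    exact hfg m

/-- Multiplication by `U` is surjective on `𝒯₀⁺`. -/
theorem tower_divisible (t : Tower) : ∃ t' : Tower, (X : ℤ[X]) • t' = t := by
  obtain ⟨f, rfl⟩ := Submodule.Quotient.mk_surjective _ t
  refine ⟨Submodule.Quotient.mk (LaurentPolynomial.T (-1) * f), ?_⟩
  rw [← Submodule.Quotient.mk_smul]
  congr 1
  change Polynomial.toLaurent _ * _ = _
  rw [Polynomial.toLaurent_X, ← mul_assoc, ← LaurentPolynomial.T_add]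
  simp

/-- This is what turns `A` into a matrix of zeros and ones on the kernel of `U`: only entries with
exponent zero survive. -/
theorem Upow_smul_of_one_le {x : ℚ} (hx : 1 ≤ x) {t : Tower} (ht : (X : ℤ[X]) • t = 0) :
    Upow x • t = 0 := by
  obtain ⟨n, hn⟩ := Nat.exists_eq_add_of_le ((Nat.one_le_floor_iff x).2 hx)
  rw [Upow, hn, pow_add, mul_comm, mul_smul, pow_one, ht, smul_zero]

theorem Upow_zero : Upow 0 = 1 := by simp [Upow]

variable {J : Type u} [Fintype J] [LinearOrder J] {Γ : PlumbingGraph J} {q : ℕ}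

theorem cochain_torsion (φ : Γ.Cochain q) : ∃ n : ℕ, (X ^ n : ℤ[X]) • φ = 0 := by
  choose M hM using tower_torsion
  refine ⟨φ.support.sup fun c => M (φ c), Finsupp.ext fun c => ?_⟩
  rw [Finsupp.smul_apply, Finsupp.zero_apply]
  by_cases h0 : φ c = 0
  · rw [h0, smul_zero]
  · exact hM _ _ (Finset.le_sup (f := fun c => M (φ c)) (Finsupp.mem_support_iff.2 h0))

theorem cochain_divisible (φ : Γ.Cochain q) : ∃ φ' : Γ.Cochain q, (X : ℤ[X]) • φ' = φ := by
  induction φ using Finsupp.induction_linear with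
  | zero => exact ⟨0, smul_zero _⟩
  | add φ ψ hφ hψ =>
    obtain ⟨φ', rfl⟩ := hφ
    obtain ⟨ψ', rfl⟩ := hψ
    exact ⟨φ' + ψ', smul_add _ _ _⟩
  | single c t =>
    obtain ⟨t', rfl⟩ := tower_divisible t
    exact ⟨Finsupp.single c t', Finsupp.smul_single _ _ _⟩

theorem ev_single (c : Γ.Cube q) (t : Tower) (k : Γ.Char) (I : Finset J) :
    ev (Finsupp.single c t) k I = if c.1 = (k, I) then t else 0 := by
  classical
  unfold ev
  split_ifs with h1 h2 h2
  · rw [Finsupp.single_apply, if_pos (Subtype.ext h2)]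
  · rw [Finsupp.single_apply, if_neg fun h => h2 (congrArg Subtype.val h)]
  · exact absurd (by rw [← c.2, h2]) h1
  · rfl

theorem ev_torsion {φ : Γ.Cochain q} (hφ : (X : ℤ[X]) • φ = 0) (k : Γ.Char) (I : Finset J) :
    (X : ℤ[X]) • ev φ k I = 0 := by
  rw [← ev_smul, hφ]
  unfold ev
  split_ifs <;> simp

theorem cochain_ext {φ ψ : Γ.Cochain q} (h : ∀ k I, I.card = q → ev φ k I = ev ψ k I) : φ = ψ := by
  ext c
  rw [ev_of_card, ev_of_card, h _ _ c.2]

end Torsion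

/-! ### Characteristic elements as lines over those of the graph with a vertex deleted. -/

section Line

/-- The parametrization `d ↦ e + 2d` of the integers congruent to `e` modulo `2`. -/
def parityEquiv (e : ℤ) : ℤ ≃ {a : ℤ // a ≡ e [ZMOD 2]} where
  toFun d := ⟨e + 2 * d, by unfold Int.ModEq; omega⟩
  invFun a := (a - e) / 2
  left_inv d := by simp
  right_inv a := by
    ext
    have := a.2
    simp only
    unfold Int.ModEq at this
    omega

variable {J V : Type u} [Fintype J] [LinearOrder J] [Fintype V] [LinearOrder V]
  {Γ : PlumbingGraph J} {Δ : PlumbingGraph V} {v : V} {ι : J ↪o V}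

/-- The characteristic elements `b(k) + (e_v + 2d) E_v^*` of `Δ` that restrict to `k` on `Γ`. -/
def line (h : IsVertexDeletion Γ Δ v ι) (hΔ : Δ.Nondegenerate) (k : Γ.Char) (d : ℤ) : Δ.Char :=
  lift h hΔ k (parityEquiv (Δ.e v) d)

theorem pairing_line_ι (h : IsVertexDeletion Γ Δ v ι) (hΔ : Δ.Nondegenerate) (k : Γ.Char) (d : ℤ)
    (j : J) : Δ.pairing (line h hΔ k d) (E (ι j)) = Γ.pairing k (E j) :=
  pairing_lift_ι h hΔ _ _ _

theorem pairing_line_v (h : IsVertexDeletion Γ Δ v ι) (hΔ : Δ.Nondegenerate) (k : Γ.Char)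
    (d : ℤ) : Δ.pairing (line h hΔ k d) (E v) = -(Δ.e v + 2 * d) := by
  rw [line, lift, pairing_lift_v h hΔ]
  simp [parityEquiv]

theorem line_inj (h : IsVertexDeletion Γ Δ v ι) (hΔ : Δ.Nondegenerate) (hΓ : Γ.Nondegenerate)
    {k k' : Γ.Char} {d d' : ℤ} : line h hΔ k d = line h hΔ k' d' ↔ k = k' ∧ d = d' := by
  constructor
  · intro heq
    have := lift_injective h hΔ hΓ (a₁ := (k, parityEquiv _ d)) (a₂ := (k', parityEquiv _ d')) heq
    rw [Prod.mk.injEq] at this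
    exact ⟨this.1, (parityEquiv _).injective this.2⟩
  · rintro ⟨rfl, rfl⟩
    rfl

/-- Seen as a functional on the lattice, `R x` is the restriction of `x` to the sublattice spanned
by the remaining vertices. -/
theorem pairing_resMap (hΓ : Γ.Nondegenerate) (x : V → ℚ) (j : J) :
    Γ.pairing (resMap Γ Δ ι x) (E j) = Δ.pairing x (E (ι j)) := by
  simp only [resMap, map_sum, map_smul, LinearMap.sum_apply, LinearMap.smul_apply,
    hΓ.pairing_Edual, smul_eq_mul]
  rw [Finset.sum_eq_single j] <;> simp +contextual [eq_comm]

/-- A characteristic element is determined by its pairings with the basis: those with the remaining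
vertices give its restriction `k`, and the one with `E v` gives the position on the line. Together
with `line_inj` this identifies `Δ.Char` with `Γ.Char × ℤ`. -/
theorem exists_line (h : IsVertexDeletion Γ Δ v ι) (hΔ : Δ.Nondegenerate) (hΓ : Γ.Nondegenerate)
    (K : Δ.Char) : ∃ k d, line h hΔ k d = K := by
  have hK := (mem_Char_iff _ _).1 K.2
  obtain ⟨n, hn⟩ := hK v
  -- The position `d` solves `-(e_v + 2d) = e_v + 2n`, the right side being the pairing with `E v`.
  refine ⟨⟨resMap Γ Δ ι K, (mem_Char_iff _ _).2 fun j => ?_⟩, -Δ.e v - n, ?_⟩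
  · rw [pairing_resMap hΓ, h.e_eq]
    exact hK _
  · refine Subtype.ext (hΔ.ext fun x => ?_)
    rcases h.cases x with rfl | ⟨j, rfl⟩
    · rw [pairing_line_v, hn]
      push_cast; ring
    · rw [pairing_line_ι, pairing_resMap hΓ]

theorem ev_line_finite (h : IsVertexDeletion Γ Δ v ι) (hΔ : Δ.Nondegenerate)
    (hΓ : Γ.Nondegenerate) {q : ℕ} (φ : Δ.Cochain q) (k : Γ.Char) (I : Finset V) :
    (Function.support fun d => ev φ (line h hΔ k d) I).Finite := by
  refine Set.Finite.of_finite_image (f := fun d => (line h hΔ k d, I))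
    ((ev_finite φ).subset ?_) ?_
  · rintro _ ⟨d, hd, rfl⟩
    exact hd
  · intro d _ d' _ heq
    simp only [Prod.mk.injEq] at heq
    exact ((line_inj h hΔ hΓ).1 heq.1).2

theorem Bsign_add_two (r : Γ.OrbitRep) (k : Γ.Char) (a : ℤ) :
    Bsign Γ Δ v ι r k (a + 2) = -Bsign Γ Δ v ι r k a := by
  have : nVal Γ Δ v ι r k (a + 2) / 2 = nVal Γ Δ v ι r k a / 2 + 1 := by
    simp only [nVal]
    push_cast; ring
  -- The floor commutes with adding `1`, so the evenness of `n(k, a)` plays no role.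
  rw [Bsign, Bsign, this, Int.floor_add_one, Int.negOnePow_succ, Units.val_neg]

/-- Along a line the sign of `B̄` alternates, up to a factor depending only on `k`. The choice of
representatives enters only through that factor, hence does not affect exactness. -/
theorem Bsign_parity (r : Γ.OrbitRep) (k : Γ.Char) (e d : ℤ) :
    Bsign Γ Δ v ι r k (e + 2 * d) = d.negOnePow * Bsign Γ Δ v ι r k e := by
  induction d using Int.induction_on with
  | zero => simp
  | succ n ih =>
    rw [mul_add, mul_one, ← add_assoc, Bsign_add_two, ih, Int.negOnePow_succ]
    simp
  | pred n ih =>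
    have := Bsign_add_two (Δ := Δ) (v := v) (ι := ι) r k (e + 2 * (-n - 1))
    rw [show e + 2 * (-(n : ℤ) - 1) + 2 = e + 2 * -n by ring, ih] at this
    rw [Int.negOnePow_sub]
    simp only [Int.negOnePow_one, Units.val_mul, Units.val_neg, Units.val_one]
    linarith

theorem Bsign_mul_self (r : Γ.OrbitRep) (k : Γ.Char) (a : ℤ) :
    Bsign Γ Δ v ι r k a * Bsign Γ Δ v ι r k a = 1 := by
  rw [Bsign, ← Units.val_mul, Int.units_mul_self, Units.val_one]

theorem ev_bOp (h : IsVertexDeletion Γ Δ v ι) (hΔ : Δ.Nondegenerate) (hΓ : Γ.Nondegenerate)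
    (ε : Γ.Char → ℤ → ℤ) {q : ℕ} (φ : Δ.Cochain q) (k : Γ.Char) {I : Finset J} (hI : I.card = q) :
    ev (bOp h hΔ hΓ ε q φ) k I = bVal h hΔ ε φ k I := by
  rw [ev, dif_pos hI]; rfl

theorem ev_Bbar (h : IsVertexDeletion Γ Δ v ι) (hΔ : Δ.Nondegenerate) (hΓ : Γ.Nondegenerate)
    (r : Γ.OrbitRep) {q : ℕ} (φ : Δ.Cochain q) (k : Γ.Char) {I : Finset J} (hI : I.card = q) :
    ev (bOp h hΔ hΓ (Bsign Γ Δ v ι r) q φ) k I = ∑ᶠ d : ℤ,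
      ((d.negOnePow : ℤˣ) * Bsign Γ Δ v ι r k (Δ.e v) : ℤ) •
        ev φ (line h hΔ k d) (I.map ι.toEmbedding) := by
  rw [ev_bOp _ _ _ _ _ _ hI, bVal, ← finsum_comp_equiv (parityEquiv (Δ.e v))]
  refine finsum_congr fun d => ?_
  rw [← Bsign_parity]
  rfl

/-- The value of `B̄` on a cochain supported at one cube `(b(k) + e_v E_v^*, I)`. -/
theorem Bbar_single (h : IsVertexDeletion Γ Δ v ι) (hΔ : Δ.Nondegenerate) (hΓ : Γ.Nondegenerate)
    (r : Γ.OrbitRep) {q : ℕ} (k : Γ.Char) (I : Finset J) (hI : I.card = q) (t : Tower) :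
    bOp h hΔ hΓ (Bsign Γ Δ v ι r) q (Finsupp.single
      ⟨(line h hΔ k 0, I.map ι.toEmbedding), by rw [Finset.card_map, hI]⟩ t) =
      Finsupp.single ⟨(k, I), hI⟩ (Bsign Γ Δ v ι r k (Δ.e v) • t) := by
  refine cochain_ext fun k' I' hI' => ?_
  rw [ev_Bbar _ _ _ _ _ _ hI', ev_single, finsum_eq_single _ (0 : ℤ), ev_single]
  · simp only [Prod.mk.injEq, line_inj h hΔ hΓ, Finset.map_inj, and_true, Int.negOnePow_zero,
      Units.val_one, one_mul]
    split_ifs with h1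
    · rw [h1.1]
    · rw [smul_zero]
  · intro d hd
    rw [ev_single, if_neg, smul_zero]
    simp [line_inj h hΔ hΓ, hd.symm]

end Line

/-! ### Weights of cubes and of their opposite faces. -/

section Weights

variable {J : Type u} [Fintype J] [LinearOrder J]

theorem EI_insert {I : Finset J} {j : J} (hj : j ∉ I) : EI (insert j I) = E j + EI I :=
  Finset.sum_insert hj

theorem weight_le_cubeWeight (Γ : PlumbingGraph J) (k : J → ℚ) {I I' : Finset J} (h : I' ⊆ I) :
    Γ.weight (k + (2 : ℚ) • EI I') ≤ Γ.cubeWeight k I :=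
  Finset.le_sup' (fun I' => Γ.weight (k + (2 : ℚ) • EI I')) (Finset.mem_powerset.2 h)

/-- The weight of a cube is the larger one of the weights of two opposite faces. -/
theorem cubeWeight_eq_max (Γ : PlumbingGraph J) (k : J → ℚ) {I : Finset J} {j : J} (hj : j ∈ I) :
    Γ.cubeWeight k I =
      max (Γ.cubeWeight k (I.erase j)) (Γ.cubeWeight (k + (2 : ℚ) • E j) (I.erase j)) := by
  refine le_antisymm (Finset.sup'_le _ _ fun I' hI' => ?_)
    (max_le (Γ.cubeWeight_erase_le k I j) (Γ.cubeWeight_shift_erase_le k hj))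
  rw [Finset.mem_powerset] at hI'
  have hsub : I'.erase j ⊆ I.erase j := Finset.erase_subset_erase _ hI'
  by_cases hjI : j ∈ I'
  · refine le_max_of_le_right ?_
    have := Γ.weight_le_cubeWeight (k + (2 : ℚ) • E j) hsub
    rwa [add_assoc, ← smul_add, ← EI_insert (Finset.notMem_erase j I'),
      Finset.insert_erase hjI] at this
  · refine le_max_of_le_left ?_
    rw [Finset.erase_eq_of_notMem hjI] at hsub
    exact Γ.weight_le_cubeWeight k hsub

/-- The weights upstairs and downstairs differ by a function of the difference of the coordinates at
`⊤` and `j₀`. When `j₀ ∉ I` this difference is the same at all vertices of the cube, so the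
correction passes through the maximum. -/
theorem cubeWeight_blowUp {Γ : PlumbingGraph J} {Γ' : PlumbingGraph (WithTop J)} {j₀ : J}
    (h : Γ' = Γ.blowUp j₀) (k : WithTop J → ℚ) {I : Finset J} (hI : j₀ ∉ I) :
    Γ'.cubeWeight k (up I) = Γ.cubeWeight (piStar k) I + ((k ⊤ - k j₀) ^ 2 - 1) / 8 := by
  have hw : ∀ I' ⊆ I, Γ'.weight (k + (2 : ℚ) • EI (up I')) =
      Γ.weight (piStar k + (2 : ℚ) • EI I') + ((k ⊤ - k j₀) ^ 2 - 1) / 8 := by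
    intro I' hI'
    rw [weight_piStar h, piStar_vertex, odd_vertex, if_neg fun hj => hI (hI' hj), sub_zero]
  apply le_antisymm
  · refine Finset.sup'_le _ _ fun I' hI' => ?_
    obtain ⟨I₀, hI₀, rfl⟩ := Finset.subset_map_iff.1 (Finset.mem_powerset.1 hI')
    rw [hw I₀ hI₀]
    gcongr
    exact Γ.weight_le_cubeWeight _ hI₀
  · rw [← le_sub_iff_add_le]
    refine Finset.sup'_le _ _ fun I' hI' => ?_
    rw [Finset.mem_powerset] at hI'
    rw [le_sub_iff_add_le, ← hw I' hI']
    exact Γ'.weight_le_cubeWeight _ (Finset.map_subset_map.2 hI')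

/-- Along a line, the weights of the two faces of a cube in the direction of `E_v` differ by a
linear function. -/
theorem exists_face_difference {V : Type u} [Fintype V] [LinearOrder V] {Γ : PlumbingGraph J}
    {Δ : PlumbingGraph V} {v : V} {ι : J ↪o V} (h : IsVertexDeletion Γ Δ v ι)
    (hΔ : Δ.Nondegenerate) (hΓ : Γ.Nondegenerate) (k : Γ.Char) {I : Finset V} (hI : v ∉ I) :
    ∃ C : ℤ, ∀ s : ℤ, Δ.cubeWeight ((line h hΔ k s : V → ℚ) + (2 : ℚ) • E v) I =
      Δ.cubeWeight (line h hΔ k s) I + (s + C : ℤ) := by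
  obtain ⟨I, rfl⟩ : ∃ I₀ : Finset J, I = I₀.map ι.toEmbedding := by
    refine ⟨I.preimage ι ι.injective.injOn, ?_⟩
    ext x
    rcases h.cases x with rfl | ⟨j, rfl⟩
    · simp [hI, h.ne]
    · simp
  -- The constant is first found as a rational number; its integrality is then read off at `s = 0`.
  have key : ∃ C : ℚ, ∀ s : ℤ, Δ.cubeWeight ((line h hΔ k s : V → ℚ) + (2 : ℚ) • E v)
      (I.map ι.toEmbedding) = Δ.cubeWeight (line h hΔ k s) (I.map ι.toEmbedding) + (s + C) := by
    -- The shift by `2 E v` moves the restriction to `Γ` from `k` to `k₁`, independently of `s`.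
    -- Both face weights are thus constants plus the weight of the base vertex, and the slope `1`
    -- comes from `χ(E v) = s` at the point `s`.
    let k₁ : J → ℚ := k + (2 : ℚ) • resMap Γ Δ ι (E v)
    refine ⟨Γ.cubeWeight k₁ I - Γ.weight k₁ - Γ.cubeWeight k I + Γ.weight k, fun s => ?_⟩
    rw [cubeWeight_map h (pairing_line_ι h hΔ k s),
      cubeWeight_map h (k := k₁) (fun j => ?_), weight_add, chi, map_add, LinearMap.add_apply,
      pairing_line_v, pairing_E_E, form_self]
    · ring
    · rw [map_add, LinearMap.add_apply, pairing_line_ι, map_add, LinearMap.add_apply, map_smul,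
        LinearMap.smul_apply, map_smul, LinearMap.smul_apply, pairing_resMap hΓ]
  obtain ⟨C, hC⟩ := key
  obtain ⟨n, hn⟩ := exp_shift_int (line h hΔ k 0) v (I.map ι.toEmbedding) (I.map ι.toEmbedding)
  have h0 := hC 0
  refine ⟨-n, fun s => ?_⟩
  rw [hC s]
  simp only [shift] at hn
  push_cast at h0 ⊢
  linarith

end Weights

/-! ### The matrix of `A` along a line. -/

section Amap

variable {J : Type u} [Fintype J] [LinearOrder J] {Γ : PlumbingGraph J} {j₀ : J}

/-- Deleting `j₀` forgets its decoration, so the lines for `Γ` and for its modification have the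
same base. -/
theorem plus_isVertexDeletion (Γ : PlumbingGraph J) (j₀ : J) :
    IsVertexDeletion (Γ.delete j₀) (Γ.plus j₀) j₀ (OrderEmbedding.subtype (· ≠ j₀)) where
  range_eq := by ext; simp
  graph_eq := rfl
  e_eq j := by simp [plus, addDecoration, delete, j.2]

theorem plus_e (Γ : PlumbingGraph J) (j₀ : J) : (Γ.plus j₀).e j₀ = Γ.e j₀ + 1 := by
  simp [plus, addDecoration]

theorem attach_pairing_plus (Γ : PlumbingGraph J) (j₀ : J) (x y : WithTop J → ℚ) :
    (Γ.attach j₀).pairing x y = (Γ.plus j₀).pairing (piStar x) (piStar y)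
      - (x ⊤ - x j₀) * (y ⊤ - y j₀) := by
  rw [blowUp_plus, blowUp_pairing]

/-- The components of the morphism of complexes `A^*`. -/
def aOp (hplus : (Γ.plus j₀).Nondegenerate) (hΓ : Γ.Nondegenerate) (q : ℕ) :
    (Γ.plus j₀).Cochain q →ₗ[ℤ[X]] Γ.Cochain q :=
  bOp (Γ.attach_isVertexDeletion j₀) (attach_nondegenerate hplus) hΓ (fun _ _ => 1) q ∘ₗ
    piOp (Γ.blowUp_plus j₀) q

/-- The odd integers `2(s - d) + 1`, indexed by `s`. -/
def oddEquiv (d : ℤ) : ℤ ≃ {a : ℤ // a ≡ -1 [ZMOD 2]} where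
  toFun s := ⟨2 * (s - d) + 1, by unfold Int.ModEq; omega⟩
  invFun a := (a - 1) / 2 + d
  left_inv s := by simp
  right_inv a := by
    ext
    have := a.2
    simp only
    unfold Int.ModEq at this
    omega

/-- The characteristic elements of `Γ^b` over the point `d` of a line in `Char(Γ)`; the one with
index `s` is mapped by `π_*` to the point `s` of the corresponding line in `Char(Γ_{j₀}^+)`. -/
def liftLine (hplus : (Γ.plus j₀).Nondegenerate) (hΓ : Γ.Nondegenerate) (k : (Γ.delete j₀).Char)
    (d s : ℤ) : (Γ.attach j₀).Char :=
  lift (Γ.attach_isVertexDeletion j₀) (attach_nondegenerate hplus)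
    (line (Γ.delete_isVertexDeletion j₀) hΓ k d) (oddEquiv d s)

theorem liftLine_top_sub (hplus : (Γ.plus j₀).Nondegenerate) (hΓ : Γ.Nondegenerate)
    (k : (Γ.delete j₀).Char) (d s : ℤ) :
    (liftLine hplus hΓ k d s : WithTop J → ℚ) ⊤ - (liftLine hplus hΓ k d s : WithTop J → ℚ) j₀ =
      2 * (s - d) + 1 := by
  have h1 : (Γ.attach j₀).pairing (liftLine hplus hΓ k d s) (E ⊤) = -(2 * (s - d) + 1) := by
    refine (pairing_lift_v (Γ.attach_isVertexDeletion j₀) (attach_nondegenerate hplus) _ _).trans ?_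
    simp [oddEquiv]
  rw [attach_pairing, piStar_E_top] at h1
  simp [E] at h1
  linarith

/-- Pairing with `E j₀` decides the index: the odd coefficient `2(s - d) + 1` of the new dual vector
turns `-(e + 2d)` into `-(e + 1 + 2s)`, with `e` the decoration of `j₀` in `Γ`. The other pairings
are unchanged. -/
theorem piChar_liftLine (hplus : (Γ.plus j₀).Nondegenerate) (hΓ : Γ.Nondegenerate)
    (k : (Γ.delete j₀).Char) (d s : ℤ) :
    piChar (Γ.blowUp_plus j₀) (liftLine hplus hΓ k d s) =
      line (Γ.plus_isVertexDeletion j₀) hplus k s := by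
  have hc := liftLine_top_sub hplus hΓ k d s
  have h1 : ∀ j : J, (Γ.attach j₀).pairing (liftLine hplus hΓ k d s) (E (j : WithTop J)) =
      Γ.pairing (line (Γ.delete_isVertexDeletion j₀) hΓ k d) (E j) := fun j =>
    pairing_lift_ι (Γ.attach_isVertexDeletion j₀) (attach_nondegenerate hplus) _ _ j
  have h2 : ∀ j : J, (Γ.attach j₀).pairing (liftLine hplus hΓ k d s) (E (j : WithTop J)) =
      (Γ.plus j₀).pairing (piStar (liftLine hplus hΓ k d s : WithTop J → ℚ)) (E j) +
        (2 * (s - d) + 1) * (if j = j₀ then 1 else 0) := by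
    intro j
    rw [attach_pairing_plus, hc, piStar_E_coe]
    by_cases hj : j = j₀
    · subst hj; simp [E]; ring
    · simp [E, hj, Ne.symm hj]
  refine Subtype.ext (hplus.ext fun x => ?_)
  have h3 := (h2 x).symm.trans (h1 x)
  simp only [piChar]
  rcases (Γ.plus_isVertexDeletion j₀).cases x with rfl | ⟨j, rfl⟩
  · rw [pairing_line_v, if_pos rfl] at h3
    rw [pairing_line_v, plus_e]
    push_cast
    linarith
  · rw [pairing_line_ι]
    have h4 := pairing_line_ι (Γ.delete_isVertexDeletion j₀) hΓ k d j
    rw [if_neg ((Γ.plus_isVertexDeletion j₀).ne j), h4] at h3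
    linarith

/-- The exponent of `U` at `φ(s, I)` in the value of `A φ` at `(d, I)`, along a line. -/
def lineExp (hplus : (Γ.plus j₀).Nondegenerate) (hΓ : Γ.Nondegenerate) (k : (Γ.delete j₀).Char)
    (I : Finset J) (d s : ℤ) : ℚ :=
  (Γ.attach j₀).cubeWeight (liftLine hplus hΓ k d s) (up I) -
    (Γ.plus j₀).cubeWeight (line (Γ.plus_isVertexDeletion j₀) hplus k s) I

theorem piStar_liftLine (hplus : (Γ.plus j₀).Nondegenerate) (hΓ : Γ.Nondegenerate)
    (k : (Γ.delete j₀).Char) (d s : ℤ) :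
    piStar (liftLine hplus hΓ k d s : WithTop J → ℚ) =
      line (Γ.plus_isVertexDeletion j₀) hplus k s :=
  congrArg Subtype.val (piChar_liftLine hplus hΓ k d s)

/-- `A` mixes neither different lines nor different sets `I`; the whole problem becomes one about a
`ℤ × ℤ` matrix of powers of `U`. -/
theorem ev_aOp (hplus : (Γ.plus j₀).Nondegenerate) (hΓ : Γ.Nondegenerate) {q : ℕ}
    (φ : (Γ.plus j₀).Cochain q) (k : (Γ.delete j₀).Char) (d : ℤ) {I : Finset J}
    (hI : I.card = q) :
    ev (aOp hplus hΓ q φ) (line (Γ.delete_isVertexDeletion j₀) hΓ k d) I =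
      ∑ᶠ s : ℤ, Upow (lineExp hplus hΓ k I d s) •
        ev φ (line (Γ.plus_isVertexDeletion j₀) hplus k s) I := by
  rw [aOp, LinearMap.comp_apply, ev_bOp _ _ _ _ _ _ hI, bVal]
  refine (finsum_comp_equiv (oddEquiv d)).symm.trans (finsum_congr fun s => ?_)
  rw [one_smul]
  change ev (piOp (Γ.blowUp_plus j₀) q φ) (liftLine hplus hΓ k d s) (up I) = _
  rw [ev, dif_pos (by rw [Finset.card_map, hI])]
  change piVal (Γ.blowUp_plus j₀) φ (liftLine hplus hΓ k d s) (up I) = _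
  rw [piVal, if_neg (top_notMem_up I), down_up, piChar_liftLine]
  rfl

theorem lineExp_of_notMem (hplus : (Γ.plus j₀).Nondegenerate) (hΓ : Γ.Nondegenerate)
    (k : (Γ.delete j₀).Char) {I : Finset J} (hI : j₀ ∉ I) (d s : ℤ) :
    lineExp hplus hΓ k I d s = ((s - d : ℤ) : ℚ) * ((s - d : ℤ) + 1) / 2 := by
  rw [lineExp, cubeWeight_blowUp (Γ.blowUp_plus j₀) _ hI, piStar_liftLine, liftLine_top_sub]
  push_cast; ring

/-- The cube weight is the maximum over the two faces in the direction of `j₀`. With `n = s - d`,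
the blow-up adds `n(n+1)/2` to the near face and `n(n-1)/2` to the far one, since the shift by `2 E
j₀` lowers the odd coordinate difference by `2`. The face weights downstairs differ by `s + C`. -/
theorem exists_lineExp_of_mem (hplus : (Γ.plus j₀).Nondegenerate) (hΓ : Γ.Nondegenerate)
    (hdel : (Γ.delete j₀).Nondegenerate) (k : (Γ.delete j₀).Char) {I : Finset J} (hI : j₀ ∈ I) :
    ∃ C : ℤ, ∀ d s : ℤ, lineExp hplus hΓ k I d s =
      max (((s - d : ℤ) : ℚ) * ((s - d : ℤ) + 1) / 2)
        ((s + C : ℤ) + ((s - d : ℤ) : ℚ) * ((s - d : ℤ) - 1) / 2) - max 0 ((s + C : ℤ) : ℚ) := by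
  have hI' := Finset.notMem_erase j₀ I
  obtain ⟨C, hC⟩ := exists_face_difference (Γ.plus_isVertexDeletion j₀) hplus hdel k hI'
  refine ⟨C, fun d s => ?_⟩
  have hup : (up I).erase (j₀ : WithTop J) = up (I.erase j₀) :=
    (Finset.map_erase WithTop.coeOrderHom.toEmbedding I j₀).symm
  have hmem : (j₀ : WithTop J) ∈ up I := Finset.mem_map_of_mem _ hI
  have hsh : piStar ((liftLine hplus hΓ k d s : WithTop J → ℚ) + (2 : ℚ) • E (j₀ : WithTop J)) =
      (line (Γ.plus_isVertexDeletion j₀) hplus k s : J → ℚ) + (2 : ℚ) • E j₀ := by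
    rw [← piStar_liftLine hplus hΓ k d s, ← piStar_E_coe (j₀ : J)]
    rfl
  have hodd : ((liftLine hplus hΓ k d s : WithTop J → ℚ) + (2 : ℚ) • E (j₀ : WithTop J)) ⊤ -
      ((liftLine hplus hΓ k d s : WithTop J → ℚ) + (2 : ℚ) • E (j₀ : WithTop J)) j₀ =
      2 * (s - d) + 1 - 2 := by
    rw [← liftLine_top_sub hplus hΓ k d s]
    simp [E]
    ring
  rw [lineExp, cubeWeight_eq_max _ _ hmem, cubeWeight_eq_max _ _ hI, hup,
    cubeWeight_blowUp (Γ.blowUp_plus j₀) _ hI', cubeWeight_blowUp (Γ.blowUp_plus j₀) _ hI', hsh,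
    hodd, piStar_liftLine, liftLine_top_sub, hC]
  -- The weight `M` of the near face is a common summand of all terms and cancels.
  generalize (Γ.plus j₀).cubeWeight _ _ = M
  rw [show M + ((2 * ((s : ℚ) - d) + 1) ^ 2 - 1) / 8 =
      M + ((s - d : ℤ) : ℚ) * ((s - d : ℤ) + 1) / 2 by push_cast; ring,
    show M + (s + C : ℤ) + ((2 * ((s : ℚ) - d) + 1 - 2) ^ 2 - 1) / 8 =
      M + ((s + C : ℤ) + ((s - d : ℤ) : ℚ) * ((s - d : ℤ) - 1) / 2) by push_cast; ring,
    max_add_add_left]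
  nth_rewrite 2 [← add_zero M]
  rw [max_add_add_left]
  ring

end Amap

/-! ### Finitely supported functions on the integers. -/

section LineSums

theorem finsum_eq_zero_of_involution {α M : Type*} [AddCommGroup M] {F : α → M}
    (hF : (Function.support F).Finite) (σ : α → α) (hσ : ∀ d, F (σ d) = -F d)
    (hne : ∀ d, σ d ≠ d) (hinv : ∀ d, σ (σ d) = d) : ∑ᶠ d, F d = 0 := by
  rw [finsum_eq_sum F hF]
  refine Finset.sum_involution (fun d _ => σ d) (fun d _ => ?_) (fun d _ _ => hne d)
    (fun d hd => ?_) fun d _ => hinv d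
  · rw [hσ, add_neg_cancel]
  · rw [Set.Finite.mem_toFinset, Function.mem_support] at hd ⊢
    rw [hσ]
    exact neg_ne_zero.2 hd

theorem finsum_ite_eq_sum {α M : Type*} [AddCommMonoid M] {f : α → M} {p : α → Prop}
    [DecidablePred p] {S : Finset α} (h : ∀ s, p s ↔ s ∈ S) :
    ∑ᶠ s, (if p s then f s else 0) = ∑ s ∈ S, f s := by
  rw [finsum_eq_sum_of_support_subset _ (s := S)]
  · exact Finset.sum_congr rfl fun s hs => if_pos ((h s).2 hs)
  · intro s hs
    by_contra hcon
    exact hs (if_neg fun hp => hcon ((h s).1 hp))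

theorem finsum_ite_eq_add {α M : Type*} [AddCommMonoid M] {f : α → M} {p : α → Prop}
    [DecidablePred p] {a b : α} (hab : a ≠ b) (h : ∀ s, p s ↔ s = a ∨ s = b) :
    ∑ᶠ s, (if p s then f s else 0) = f a + f b := by
  classical
  rw [finsum_ite_eq_sum (S := {a, b}) (by simpa using h), Finset.sum_pair hab]

variable {M : Type*} [AddCommGroup M] {f : ℤ → M}

/-- A non-zero value would propagate to all smaller integers, against the finiteness of the support.
-/
theorem eq_zero_of_add_pred_eq_zero (hf : (Function.support f).Finite) {N : ℤ}
    (h : ∀ d ≤ N, f d + f (d - 1) = 0) : ∀ d ≤ N, f d = 0 := by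
  intro d hd
  by_contra h0
  have hne : ∀ n : ℕ, f (d - n) ≠ 0 := by
    intro n
    induction n with
    | zero => simpa using h0
    | succ n ih =>
      have := h (d - n) (by omega)
      push_cast
      rw [← sub_sub]
      intro h1
      rw [h1, add_zero] at this
      exact ih this
  refine (Set.infinite_range_of_injective (f := fun n : ℕ => d - (n : ℤ)) ?_).mono ?_ hf
  · intro a b hab
    simpa using hab
  · rintro _ ⟨n, rfl⟩
    exact hne n

theorem eq_zero_of_add_succ_eq_zero (hf : (Function.support f).Finite) {N : ℤ}
    (h : ∀ d, N ≤ d → f d + f (d + 1) = 0) : ∀ d, N ≤ d → f d = 0 := by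
  intro d hd
  have hf' : (Function.support fun d => f (-d)).Finite :=
    hf.preimage (f := fun d : ℤ => -d) neg_injective.injOn
  have := eq_zero_of_add_pred_eq_zero hf' (N := -N)
    (fun d hd => by rw [neg_sub, sub_eq_neg_add]; exact h (-d) (by omega)) (-d) (by omega)
  simpa using this

end LineSums

/-! ### Injectivity, vanishing of the composite, surjectivity and exactness in the middle. -/

section Exactness

variable {J : Type u} [Fintype J] [LinearOrder J] {Γ : PlumbingGraph J} {j₀ : J} {q : ℕ}

/-- The number `n(n+1)/2` is zero for `n = 0, -1` and at least `1` for all other integers. -/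
theorem Upow_lineExp_of_notMem (hplus : (Γ.plus j₀).Nondegenerate) (hΓ : Γ.Nondegenerate)
    (k : (Γ.delete j₀).Char) {I : Finset J} (hI : j₀ ∉ I) (d s : ℤ) {t : Tower}
    (ht : (X : ℤ[X]) • t = 0) :
    Upow (lineExp hplus hΓ k I d s) • t = if s = d ∨ s + 1 = d then t else 0 := by
  rw [lineExp_of_notMem hplus hΓ k hI]
  obtain ⟨n, rfl⟩ : ∃ n, s = d + n := ⟨s - d, by ring⟩
  rw [add_sub_cancel_left]
  split_ifs with h
  · rcases (by omega : n = 0 ∨ n = -1) with rfl | rfl <;> simp [Upow_zero]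
  · refine Upow_smul_of_one_le ?_ ht
    have : 2 ≤ n * (n + 1) := by
      rcases (by omega : 1 ≤ n ∨ n ≤ -2) with h | h <;> nlinarith
    rw [le_div_iff₀ two_pos]
    exact_mod_cast this

theorem exists_Upow_lineExp_of_mem (hplus : (Γ.plus j₀).Nondegenerate) (hΓ : Γ.Nondegenerate)
    (hdel : (Γ.delete j₀).Nondegenerate) (k : (Γ.delete j₀).Char) {I : Finset J} (hI : j₀ ∈ I) :
    ∃ C : ℤ, ∀ (d s : ℤ) {t : Tower}, (X : ℤ[X]) • t = 0 →
      Upow (lineExp hplus hΓ k I d s) • t =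
        if s = d ∨ (s < C ∧ s + 1 = d) ∨ (C < s ∧ s = d + 1) then t else 0 := by
  obtain ⟨C, hC⟩ := exists_lineExp_of_mem hplus hΓ hdel k hI
  -- The threshold is the point of the line where the two faces have equal weight, that is, where `m
  -- = s + C` vanishes.
  refine ⟨-C, fun d s t ht => ?_⟩
  rw [hC]
  obtain ⟨n, rfl⟩ : ∃ n, s = d + n := ⟨s - d, by ring⟩
  rw [add_sub_cancel_left]
  obtain ⟨m, hm⟩ : ∃ m, d + n + C = m := ⟨_, rfl⟩
  rw [hm]
  split_ifs with h
  · have h0 : max ((n : ℚ) * (n + 1) / 2) (m + (n : ℚ) * (n - 1) / 2) - max 0 (m : ℚ) = 0 := by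
      rcases (by omega : n = 0 ∨ (n = -1 ∧ m ≤ -1) ∨ (n = 1 ∧ 1 ≤ m)) with rfl | ⟨rfl, h'⟩ | ⟨rfl, h'⟩
      · simp
      · have h2 : (m : ℚ) ≤ -1 := by exact_mod_cast h'
        rw [max_eq_left, max_eq_left] <;> push_cast <;> linarith
      · have h2 : (1 : ℚ) ≤ m := by exact_mod_cast h'
        rw [max_eq_right, max_eq_right] <;> push_cast <;> linarith
    rw [h0, Upow_zero, one_smul]
  · refine Upow_smul_of_one_le ?_ ht
    -- The exponent is bounded below by the term of the face that is heavier downstairs. The one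
    -- exception is `n = 1`, `m = 0`, where the near face gives the bound `1`.
    rcases le_or_gt 0 m with h' | h'
    · have h2 : (0 : ℚ) ≤ m := by exact_mod_cast h'
      rw [max_eq_right h2]
      rcases (by omega : n = -1 ∨ (n = 1 ∧ m = 0) ∨ 2 ≤ n ∨ n ≤ -2) with rfl | ⟨rfl, rfl⟩ | hn
      · have := le_max_right (((-1 : ℤ) : ℚ) * ((-1 : ℤ) + 1) / 2)
          (m + ((-1 : ℤ) : ℚ) * ((-1 : ℤ) - 1) / 2)
        push_cast at this ⊢
        linarith
      · norm_num
      · have h3 : 2 ≤ n * (n - 1) := by rcases hn with hn | hn <;> nlinarith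
        have h4 : (2 : ℚ) ≤ n * (n - 1) := by exact_mod_cast h3
        have := le_max_right ((n : ℚ) * (n + 1) / 2) (m + (n : ℚ) * (n - 1) / 2)
        linarith
    · have h2 : (m : ℚ) ≤ 0 := by exact_mod_cast h'.le
      rw [max_eq_left h2, sub_zero]
      refine le_trans ?_ (le_max_left _ _)
      have h3 : 2 ≤ n * (n + 1) := by
        rcases (by omega : 1 ≤ n ∨ n ≤ -2) with hn | hn <;> nlinarith
      have h4 : (2 : ℚ) ≤ n * (n + 1) := by exact_mod_cast h3
      linarith

/-- If `j₀ ∈ I`, the equations at the points below `C` involve only values below `C`, and those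
above only values above. Each half-line vanishes by finite support, and the equation at `C` gives
the last value. If `j₀ ∉ I`, a single downward recursion suffices. -/
theorem aOp_eq_zero_of_torsion (hplus : (Γ.plus j₀).Nondegenerate) (hΓ : Γ.Nondegenerate)
    (hdel : (Γ.delete j₀).Nondegenerate) (φ : (Γ.plus j₀).Cochain q)
    (hφ : (X : ℤ[X]) • φ = 0) (h0 : aOp hplus hΓ q φ = 0) : φ = 0 := by
  refine cochain_ext fun K I hI => ?_
  obtain ⟨k, s, rfl⟩ := exists_line (Γ.plus_isVertexDeletion j₀) hplus hdel K
  have hz : ∀ K, ev (0 : (Γ.plus j₀).Cochain q) K I = 0 := fun K => by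
    simp [ev]
  rw [hz]
  have hA : ∀ d, ∑ᶠ s : ℤ, Upow (lineExp hplus hΓ k I d s) •
      ev φ (line (Γ.plus_isVertexDeletion j₀) hplus k s) I = 0 := by
    intro d
    rw [← ev_aOp hplus hΓ φ k d hI, h0]
    simp [ev]
  have ht : ∀ s, (X : ℤ[X]) • ev φ (line (Γ.plus_isVertexDeletion j₀) hplus k s) I = 0 :=
    fun s => ev_torsion hφ _ _
  have hfin := ev_line_finite (Γ.plus_isVertexDeletion j₀) hplus hdel φ k I
  by_cases hj : j₀ ∈ I
  · obtain ⟨C, hC⟩ := exists_Upow_lineExp_of_mem hplus hΓ hdel k hj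
    simp only [hC _ _ (ht _)] at hA
    have hneg := eq_zero_of_add_pred_eq_zero hfin (N := C - 1) fun d hd => by
      exact (finsum_ite_eq_add (by omega) fun s => by omega).symm.trans (hA d)
    have hpos := eq_zero_of_add_succ_eq_zero hfin (N := C + 1) fun d hd => by
      exact (finsum_ite_eq_add (by omega) fun s => by omega).symm.trans (hA d)
    rcases lt_trichotomy s C with h | rfl | h
    · exact hneg s (by omega)
    -- At the threshold three terms occur, and the two neighbours are already known to vanish.
    · have h1 := hA s
      rw [finsum_ite_eq_sum (S := {s, s - 1, s + 1}) fun s' => by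
        simp only [Finset.mem_insert, Finset.mem_singleton]; omega,
        Finset.sum_insert (by simp only [Finset.mem_insert, Finset.mem_singleton]; omega), Finset.sum_pair (by omega), hneg _ le_rfl, hpos _ le_rfl,
        add_zero, add_zero] at h1
      exact h1
    · exact hpos s (by omega)
  · simp only [Upow_lineExp_of_notMem hplus hΓ k hj _ _ (ht _)] at hA
    refine eq_zero_of_add_pred_eq_zero hfin (N := s) (fun d _ => ?_) s le_rfl
    exact (finsum_ite_eq_add (by omega) fun s => by omega).symm.trans (hA d)

theorem ev_aOp_single (hplus : (Γ.plus j₀).Nondegenerate) (hΓ : Γ.Nondegenerate)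
    (hdel : (Γ.delete j₀).Nondegenerate) (k : (Γ.delete j₀).Char) (s : ℤ) {I : Finset J}
    (hI : I.card = q) (t : Tower) (k' : (Γ.delete j₀).Char) (d : ℤ) {I' : Finset J}
    (hI' : I'.card = q) :
    ev (aOp hplus hΓ q (Finsupp.single
        ⟨(line (Γ.plus_isVertexDeletion j₀) hplus k s, I), hI⟩ t))
      (line (Γ.delete_isVertexDeletion j₀) hΓ k' d) I' =
      if k = k' ∧ I = I' then Upow (lineExp hplus hΓ k I d s) • t else 0 := by
  rw [ev_aOp hplus hΓ _ k' d hI', finsum_eq_single _ s]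
  · simp only [ev_single, Prod.mk.injEq, line_inj _ hplus hdel, and_true]
    split_ifs with h
    · rw [h.1, h.2]
    · rw [smul_zero]
  · intro s' hs'
    rw [ev_single, if_neg, smul_zero]
    simp [line_inj _ hplus hdel, hs'.symm]

theorem aOp_single (hplus : (Γ.plus j₀).Nondegenerate) (hΓ : Γ.Nondegenerate)
    (hdel : (Γ.delete j₀).Nondegenerate) (k : (Γ.delete j₀).Char) (s : ℤ) {I : Finset J}
    (hI : I.card = q) (t : Tower) (S : Finset ℤ)
    (hS : ∀ d, Upow (lineExp hplus hΓ k I d s) • t = if d ∈ S then t else 0) :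
    aOp hplus hΓ q (Finsupp.single ⟨(line (Γ.plus_isVertexDeletion j₀) hplus k s, I), hI⟩ t) =
      ∑ d ∈ S, Finsupp.single ⟨(line (Γ.delete_isVertexDeletion j₀) hΓ k d, I), hI⟩ t := by
  classical
  refine Finsupp.ext fun c => ?_
  obtain ⟨⟨K, I'⟩, hI'⟩ := c
  obtain ⟨k', d, rfl⟩ := exists_line (Γ.delete_isVertexDeletion j₀) hΓ hdel K
  rw [ev_of_card, ev_aOp_single hplus hΓ hdel k s hI t k' d hI', hS, Finsupp.finsetSum_apply]
  simp only [Finsupp.single_apply, Subtype.mk.injEq, Prod.mk.injEq, line_inj _ hΓ hdel]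
  by_cases h : k = k' ∧ I = I'
  · simp [h.1, h.2]
  · rw [if_neg h, Finset.sum_eq_zero]
    intro d' _
    rw [if_neg]
    tauto

/-- The components of the morphism of complexes `B̄^*`. -/
abbrev bbarOp (hΓ : Γ.Nondegenerate) (hdel : (Γ.delete j₀).Nondegenerate)
    (r : (Γ.delete j₀).OrbitRep) (q : ℕ) : Γ.Cochain q →ₗ[ℤ[X]] (Γ.delete j₀).Cochain q :=
  bOp (Γ.delete_isVertexDeletion j₀) hΓ hdel
    (Bsign (Γ.delete j₀) Γ j₀ (OrderEmbedding.subtype (· ≠ j₀)) r) q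

/-- The cubes seen by `B̄` do not contain `j₀`, so only triangular exponents occur. In the
alternating sum over `d` the reflection `d ↦ 2s + 1 - d` keeps the exponent and changes the sign. -/
theorem Bbar_aOp (hplus : (Γ.plus j₀).Nondegenerate) (hΓ : Γ.Nondegenerate)
    (hdel : (Γ.delete j₀).Nondegenerate) (r : (Γ.delete j₀).OrbitRep)
    (φ : (Γ.plus j₀).Cochain q) :
    bbarOp hΓ hdel r q (aOp hplus hΓ q φ) = 0 := by
  induction φ using Finsupp.induction_linear with
  | zero => rw [map_zero, map_zero]
  | add φ ψ hφ hψ => rw [map_add, map_add, hφ, hψ, add_zero]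
  | single c t =>
    obtain ⟨⟨K, I⟩, hI⟩ := c
    obtain ⟨k, s, rfl⟩ := exists_line (Γ.plus_isVertexDeletion j₀) hplus hdel K
    refine Finsupp.ext fun c => ?_
    obtain ⟨⟨k', I'⟩, hI'⟩ := c
    have hc : (I'.map (OrderEmbedding.subtype (· ≠ j₀)).toEmbedding).card = q := by
      rw [Finset.card_map]; exact hI'
    have hj : j₀ ∉ I'.map (OrderEmbedding.subtype (· ≠ j₀)).toEmbedding := by simp
    rw [ev_of_card, ev_Bbar _ _ _ _ _ _ hI', Finsupp.zero_apply]
    refine finsum_eq_zero_of_involution (smul_support_finite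
      (ev_line_finite _ hΓ hdel _ k' _) _) (fun d => 2 * s + 1 - d) (fun d => ?_)
      (fun d => by omega) (fun d => by omega)
    have hsign : ((2 * s + 1 - d).negOnePow : ℤ) = -d.negOnePow := by
      rw [Int.negOnePow_sub, Int.negOnePow_succ, Int.negOnePow_even _ (even_two_mul s)]
      simp
    rw [ev_aOp_single hplus hΓ hdel k s hI t _ _ hc, ev_aOp_single hplus hΓ hdel k s hI t _ _ hc,
      hsign, neg_mul, neg_smul]
    split_ifs with h
    · rw [h.2, lineExp_of_notMem hplus hΓ k hj, lineExp_of_notMem hplus hΓ k hj]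
      congr 4
      push_cast; ring
    · rfl

theorem Bbar_surjective (hΓ : Γ.Nondegenerate)
    (hdel : (Γ.delete j₀).Nondegenerate) (r : (Γ.delete j₀).OrbitRep) :
    Function.Surjective
      (bbarOp hΓ hdel r q) := by
  intro χ
  induction χ using Finsupp.induction_linear with
  | zero => exact ⟨0, map_zero _⟩
  | add φ ψ hφ hψ =>
    obtain ⟨φ', rfl⟩ := hφ
    obtain ⟨ψ', rfl⟩ := hψ
    exact ⟨φ' + ψ', map_add _ _ _⟩
  | single c t =>
    obtain ⟨⟨k, I⟩, hI⟩ := c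
    refine ⟨_, (Bbar_single _ hΓ hdel r k I hI 
      (Bsign (Γ.delete j₀) Γ j₀ (OrderEmbedding.subtype (· ≠ j₀)) r k (Γ.e j₀) • t)).trans ?_⟩
    rw [← mul_smul, Bsign_mul_self, one_smul]

/-- The cochains of `Γ ∖ j₀`, put on the points `0` of the lines in `Char(Γ)`. -/
def baseOp (hΓ : Γ.Nondegenerate) (q : ℕ) : (Γ.delete j₀).Cochain q →ₗ[ℤ[X]] Γ.Cochain q :=
  Finsupp.lmapDomain Tower ℤ[X] fun c =>
    ⟨(line (Γ.delete_isVertexDeletion j₀) hΓ c.1.1 0,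
      c.1.2.map (OrderEmbedding.subtype (· ≠ j₀)).toEmbedding), by rw [Finset.card_map, c.2]⟩

theorem baseOp_single (hΓ : Γ.Nondegenerate) (c : (Γ.delete j₀).Cube q) (t : Tower) :
    baseOp hΓ q (Finsupp.single c t) = Finsupp.single
      ⟨(line (Γ.delete_isVertexDeletion j₀) hΓ c.1.1 0,
        c.1.2.map (OrderEmbedding.subtype (· ≠ j₀)).toEmbedding),
          by rw [Finset.card_map, c.2]⟩ t :=
  Finsupp.mapDomain_single

/-- Up to signs `baseOp` is a section of `B̄`, so `B̄` is injective on its range. -/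
theorem Bbar_baseOp_apply (hΓ : Γ.Nondegenerate)
    (hdel : (Γ.delete j₀).Nondegenerate) (r : (Γ.delete j₀).OrbitRep)
    (χ : (Γ.delete j₀).Cochain q) (c : (Γ.delete j₀).Cube q) :
    bbarOp hΓ hdel r q (baseOp hΓ q χ) c =
      Bsign (Γ.delete j₀) Γ j₀ (OrderEmbedding.subtype (· ≠ j₀)) r c.1.1 (Γ.e j₀) • χ c := by
  classical
  induction χ using Finsupp.induction_linear with
  | zero => simp
  | add φ ψ hφ hψ =>
    rw [map_add, map_add, Finsupp.add_apply, Finsupp.add_apply, hφ, hψ, smul_add]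
  | single c' t =>
    rw [baseOp_single, Bbar_single _ hΓ hdel r c'.1.1 c'.1.2 c'.2 t]
    change Finsupp.single c' _ c = _
    rw [Finsupp.single_apply, Finsupp.single_apply]
    split_ifs with h
    · rw [h]
    · rw [smul_zero]

/-- Modulo the range of `A`, neighbouring generators on a line are negatives of each other, so each
is a sign times the generator at the point `0`, which lies in the range of `baseOp`. -/
theorem single_mem_of_notMem (hplus : (Γ.plus j₀).Nondegenerate) (hΓ : Γ.Nondegenerate)
    (hdel : (Γ.delete j₀).Nondegenerate) (k : (Γ.delete j₀).Char) (d : ℤ) {I : Finset J}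
    (hI : I.card = q) (hj : j₀ ∉ I) {t : Tower} (ht : (X : ℤ[X]) • t = 0) :
    Finsupp.single ⟨(line (Γ.delete_isVertexDeletion j₀) hΓ k d, I), hI⟩ t ∈
      LinearMap.range (aOp hplus hΓ q) ⊔ LinearMap.range (baseOp (j₀ := j₀) hΓ q) := by
  set R := LinearMap.range (aOp hplus hΓ q) ⊔ LinearMap.range (baseOp (j₀ := j₀) hΓ q)
  set x : ℤ → Γ.Cochain q := fun d =>
    Finsupp.single ⟨(line (Γ.delete_isVertexDeletion j₀) hΓ k d, I), hI⟩ t with hx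
  have hstep : ∀ s, x s + x (s + 1) ∈ R := by
    intro s
    refine Submodule.mem_sup_left ⟨_, (aOp_single hplus hΓ hdel k s hI t {s, s + 1} ?_).trans
      (Finset.sum_pair (by omega))⟩
    intro d
    rw [Upow_lineExp_of_notMem hplus hΓ k hj d s ht]
    simp only [Finset.mem_insert, Finset.mem_singleton, eq_comm]
  have hmap : (I.subtype (· ≠ j₀)).map (OrderEmbedding.subtype (· ≠ j₀)).toEmbedding = I :=
    Finset.subtype_map_of_mem fun i hi h => hj (h ▸ hi)
  change x d ∈ R
  induction d using Int.induction_on with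
  | zero =>
    refine Submodule.mem_sup_right ⟨Finsupp.single
      ⟨(k, I.subtype (· ≠ j₀)), ?_⟩ t, ?_⟩
    · rw [← hI, ← Finset.card_map, hmap]
    · rw [baseOp_single]
      simp only [hx, hmap]
  | succ n ih => exact (Submodule.add_mem_iff_right R ih).1 (hstep n)
  | pred n ih =>
    have := hstep (-n - 1)
    rw [sub_add_cancel] at this
    exact (Submodule.add_mem_iff_left R ih).1 this

/-- The generator at the threshold `C` is itself an image, and the images of the others allow an
induction away from `C` in both directions; no complement is needed. -/
theorem single_mem_of_mem (hplus : (Γ.plus j₀).Nondegenerate) (hΓ : Γ.Nondegenerate)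
    (hdel : (Γ.delete j₀).Nondegenerate) (k : (Γ.delete j₀).Char) (d : ℤ) {I : Finset J}
    (hI : I.card = q) (hj : j₀ ∈ I) {t : Tower} (ht : (X : ℤ[X]) • t = 0) :
    Finsupp.single ⟨(line (Γ.delete_isVertexDeletion j₀) hΓ k d, I), hI⟩ t ∈
      LinearMap.range (aOp hplus hΓ q) := by
  obtain ⟨C, hC⟩ := exists_Upow_lineExp_of_mem hplus hΓ hdel k hj
  set R := LinearMap.range (aOp hplus hΓ q)
  set x : ℤ → Γ.Cochain q := fun d =>
    Finsupp.single ⟨(line (Γ.delete_isVertexDeletion j₀) hΓ k d, I), hI⟩ t with hx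
  have hmem : ∀ (s : ℤ) (S : Finset ℤ),
      (∀ d, (s = d ∨ (s < C ∧ s + 1 = d) ∨ (C < s ∧ s = d + 1)) ↔ d ∈ S) → ∑ d ∈ S, x d ∈ R := by
    intro s S hS
    refine ⟨_, aOp_single hplus hΓ hdel k s hI t S fun d => ?_⟩
    rw [hC d s ht]
    simp only [hS]
  have h0 : x C ∈ R := by
    have := hmem C {C} fun d => by rw [Finset.mem_singleton]; omega
    rwa [Finset.sum_singleton] at this
  change x d ∈ R
  rcases le_total C d with h | h
  · induction d, h using Int.leInduction with
    | base => exact h0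
    | succ d hd ih =>
      have := hmem (d + 1) {d, d + 1} fun d' => by
        rw [Finset.mem_insert, Finset.mem_singleton]; omega
      rw [Finset.sum_pair (by omega)] at this
      exact (Submodule.add_mem_iff_right R ih).1 this
  · induction d, h using Int.leInductionDown with
    | base => exact h0
    | pred d hd ih =>
      have := hmem (d - 1) {d - 1, d} fun d' => by
        rw [Finset.mem_insert, Finset.mem_singleton]; omega
      rw [Finset.sum_pair (by omega)] at this
      exact (Submodule.add_mem_iff_left R ih).1 this

/-- A cochain killed by `U` is an image under `A` plus a cochain from `baseOp`. If `B̄` kills it,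
the second summand vanishes, because `B̄ A = 0` and `B̄` is injective on that range. -/
theorem exists_aOp_eq_of_torsion (hplus : (Γ.plus j₀).Nondegenerate) (hΓ : Γ.Nondegenerate)
    (hdel : (Γ.delete j₀).Nondegenerate) (r : (Γ.delete j₀).OrbitRep) (ψ : Γ.Cochain q)
    (hψ : (X : ℤ[X]) • ψ = 0)
    (h0 : bbarOp hΓ hdel r q ψ = 0) :
    ∃ φ, aOp hplus hΓ q φ = ψ := by
  have hmem : ψ ∈ LinearMap.range (aOp hplus hΓ q) ⊔ LinearMap.range (baseOp (j₀ := j₀) hΓ q) := by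
    rw [← Finsupp.sum_single ψ]
    refine Submodule.sum_mem _ fun c _ => ?_
    have ht : (X : ℤ[X]) • ψ c = 0 := by rw [← Finsupp.smul_apply, hψ, Finsupp.zero_apply]
    obtain ⟨⟨K, I⟩, hI⟩ := c
    obtain ⟨k, d, rfl⟩ := exists_line (Γ.delete_isVertexDeletion j₀) hΓ hdel K
    by_cases hj : j₀ ∈ I
    · exact Submodule.mem_sup_left (single_mem_of_mem hplus hΓ hdel k d hI hj ht)
    · exact single_mem_of_notMem hplus hΓ hdel k d hI hj ht
  obtain ⟨_, ⟨φ, rfl⟩, _, ⟨χ, rfl⟩, rfl⟩ := Submodule.mem_sup.1 hmem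
  have hχ : χ = 0 := by
    refine Finsupp.ext fun c => ?_
    have := Bbar_baseOp_apply hΓ hdel r χ c
    rw [map_add, Bbar_aOp, zero_add] at h0
    rw [h0, Finsupp.zero_apply] at this
    rw [Finsupp.zero_apply]
    have h1 := congrArg (fun y =>
      Bsign (Γ.delete j₀) Γ j₀ (OrderEmbedding.subtype (· ≠ j₀)) r c.1.1 (Γ.e j₀) • y) this
    simpa only [smul_zero, ← mul_smul, Bsign_mul_self, one_smul] using h1.symm
  exact ⟨φ, by rw [hχ, map_zero, add_zero]⟩

end Exactness

end PlumbingGraph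

end

/-! ### The short exact sequence and its long exact sequence. -/

open CategoryTheory PlumbingGraph in
/-- The sequence `0 → ℱ^*(Γ_{j₀}^+) → ℱ^*(Γ) → ℱ^*(Γ ∖ j₀) → 0` with the maps `A^*`, `B̄^*` is a short
exact sequence of complexes of `ℤ[U]`-modules, and the induced long sequence of lattice cohomologies
(with the connecting homomorphisms of the short exact sequence) is exact; it begins with
`0 → ℍ^0(Γ_{j₀}^+)`. -/
theorem theorem5p6 {J : Type*} [Fintype J] [LinearOrder J] (Γ : PlumbingGraph J) (j₀ : J)
    (hplus : (Γ.plus j₀).Nondegenerate) (hΓ : Γ.Nondegenerate)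
    (hdel : (Γ.delete j₀).Nondegenerate) (r : (Γ.delete j₀).OrbitRep) :
    ∃ (hzero : Γ.Ahom j₀ hplus hΓ ≫ Γ.BbarDelete j₀ hΓ hdel r = 0)
      (hS : (ShortComplex.mk (Γ.Ahom j₀ hplus hΓ) (Γ.BbarDelete j₀ hΓ hdel r) hzero).ShortExact)
      (C : ∀ q : ℕ, (Γ.delete j₀).latticeCohomology q ⟶ (Γ.plus j₀).latticeCohomology (q + 1)),
      (∀ q, C q = hS.δ q (q + 1) rfl) ∧
      Function.Injective (HomologicalComplex.homologyMap (Γ.Ahom j₀ hplus hΓ) 0).hom ∧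
      ∀ q : ℕ,
        Function.Exact (HomologicalComplex.homologyMap (Γ.Ahom j₀ hplus hΓ) q).hom
          (HomologicalComplex.homologyMap (Γ.BbarDelete j₀ hΓ hdel r) q).hom ∧
        Function.Exact (HomologicalComplex.homologyMap (Γ.BbarDelete j₀ hΓ hdel r) q).hom
          (C q).hom ∧
        Function.Exact (C q).hom
          (HomologicalComplex.homologyMap (Γ.Ahom j₀ hplus hΓ) (q + 1)).hom := by
  have hzero : Γ.Ahom j₀ hplus hΓ ≫ Γ.BbarDelete j₀ hΓ hdel r = 0 := by
    refine HomologicalComplex.hom_ext _ _ fun q => ?_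
    ext1
    exact LinearMap.ext fun φ => Bbar_aOp hplus hΓ hdel r φ
  have hinj : ∀ q, Function.Injective (aOp hplus hΓ q) := fun q =>
    injective_of_injective_on_ker _ cochain_torsion (aOp_eq_zero_of_torsion hplus hΓ hdel)
  have hS : (ShortComplex.mk (Γ.Ahom j₀ hplus hΓ) (Γ.BbarDelete j₀ hΓ hdel r) hzero).ShortExact := by
    refine HomologicalComplex.shortExact_of_degreewise_shortExact _ fun q => ?_
    exact ModuleCat.shortComplex_shortExact _
      (exact_of_exact_on_ker (aOp hplus hΓ q) _ (Bbar_aOp hplus hΓ hdel r) cochain_torsion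
        cochain_divisible (exists_aOp_eq_of_torsion hplus hΓ hdel r))
      (hinj q) (Bbar_surjective hΓ hdel r)
  refine ⟨hzero, hS, fun q => hS.δ q (q + 1) rfl, fun _ => rfl, ?_, fun q => ⟨?_, ?_, ?_⟩⟩
  -- No differential enters degree `0`, so injectivity on cochains passes to cohomology there.
  · have : Mono ((Γ.Ahom j₀ hplus hΓ).f 0) := (ModuleCat.mono_iff_injective _).2 (hinj 0)
    exact (ModuleCat.mono_iff_injective _).1
      (HomologicalComplex.mono_homologyMap_of_mono_of_not_rel _ 0 (by simp))
  · exact (ShortComplex.ShortExact.moduleCat_exact_iff_function_exact _).1 (hS.homology_exact₂ q)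
  · exact (ShortComplex.ShortExact.moduleCat_exact_iff_function_exact _).1
      (hS.homology_exact₃ q (q + 1) rfl)
  · exact (ShortComplex.ShortExact.moduleCat_exact_iff_function_exact _).1
      (hS.homology_exact₁ q (q + 1) rfl)
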